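/- Let $(M,g)$ be a Lorentzian manifold: a smooth (Hausdorff, second countable) manifold with a smooth symmetric $2$-tensor field $g=\langle\cdot,\cdot\rangle$ of signature $(-+\cdots+)$. A smooth timelike vector field $T$ determines a time orientation, in which a nonzero vector $v$ with $\langle v,v\rangle\le 0$ is future-pointing if $\langle v,T\rangle<0$, and past-pointing if it is future-pointing for $-T$. A future-directed causal curve is a smooth curve $c:I\subset\mathbb R\to M$ on an interval such that each $\dot c(u)$ is non-spacelike and, if nonzero, future-pointing. $J^+(p)$ (resp. $J^-(p)$) is the set of points to which $p$ can be connected by a future-directed (resp. past-directed) causal curve $c:[a,b]\to M$. For $S\subset M$, $D^-(S)$ is the set of points $p$ such that every future-directed causal curve $c:[a,b)\to M$, $a<b\le+\infty$, which starts at $p$ and is inextendible (i.e. $\lim_{u\to b}c(u)$ does not exist in $M$) intersects $S$; $D^+(S)$ is defined in the same way with past-directed curves; and $D(S)=D^+(S)\cup D^-(S)$. A global time function is a smooth $t:M\to\mathbb R$ whose gradient is everywhere timelike, and $(M,g)$ is stably causal if it has one. $(M,g)$ is globally hyperbolic if it is stably causal and there is a global time function $t$ such that every nonempty time slice $S_a=t^{-1}(a)$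 satisfies $D(S_a)=M$ (for the time orientation defined by $-\operatorname{grad} t$). Let $(M,g)$ be a globally hyperbolic Lorentzian manifold with a time orientation, and let $p,q\in M$. Then: (i) $J^+(p)$ is closed; (ii) $J^+(p)\cap J^-(q)$ is compact. -/

import Mathlib

open Set Filter Topology Bundle Manifold
open scoped ContDiff

noncomputable section

/-- A smooth Lorentzian metric on the `(m+1)`-dimensional smooth manifold `M`: a smooth symmetric
`2`-tensor field of signature `(- + ... +)` at every point (in particular nondegenerate). -/
structure LorentzMetric (m : ℕ) (M : Type*) [TopologicalSpace M]
    [ChartedSpace (EuclideanSpace ℝ (Fin (m + 1))) M] [IsManifold (𝓡 (m + 1)) ∞ M] where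
  /-- The scalar product `⟨v, w⟩` on each tangent space. -/
  inner (x : M) :
    TangentSpace (𝓡 (m + 1)) x →L[ℝ] TangentSpace (𝓡 (m + 1)) x →L[ℝ] ℝ
  symm (x : M) (v w : TangentSpace (𝓡 (m + 1)) x) : inner x v w = inner x w v
  signature (x : M) : ∃ b : Module.Basis (Fin (m + 1)) ℝ (TangentSpace (𝓡 (m + 1)) x),
    ∀ i j, inner x (b i) (b j) = if i = j then (if i = 0 then -1 else 1) else 0
  contMDiff : ContMDiff (𝓡 (m + 1))
    ((𝓡 (m + 1)).prod 𝓘(ℝ, EuclideanSpace ℝ (Fin (m + 1)) →L[ℝ]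
      EuclideanSpace ℝ (Fin (m + 1)) →L[ℝ] ℝ)) ∞
    (fun x ↦ TotalSpace.mk' (EuclideanSpace ℝ (Fin (m + 1)) →L[ℝ]
      EuclideanSpace ℝ (Fin (m + 1)) →L[ℝ] ℝ) x (inner x))

namespace LorentzMetric

variable {m : ℕ} {M : Type*} [TopologicalSpace M]
  [ChartedSpace (EuclideanSpace ℝ (Fin (m + 1))) M] [IsManifold (𝓡 (m + 1)) ∞ M]
  (g : LorentzMetric m M)

/-- Nondegeneracy: a vector orthogonal to all vectors is zero. -/
theorem eq_zero_of_inner_eq_zero (x : M) (v : TangentSpace (𝓡 (m + 1)) x)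
    (h : ∀ w, g.inner x v w = 0) : v = 0 := by
  obtain ⟨b, hb⟩ := g.signature x
  apply b.repr.map_eq_zero_iff.1
  ext i
  have hi := h (b i)
  rw [← b.sum_repr v] at hi
  simp only [map_sum, map_smul, sum_apply, smul_apply,
    hb, smul_eq_mul, mul_ite, mul_zero, Finset.sum_ite_eq', Finset.mem_univ, if_true] at hi
  split_ifs at hi <;> simpa using hi

/-- By nondegeneracy every covector is represented by exactly one vector. -/
theorem exists_inner_eq (x : M) (α : TangentSpace (𝓡 (m + 1)) x →L[ℝ] ℝ) :
    ∃ v : TangentSpace (𝓡 (m + 1)) x, ∀ w, g.inner x v w = α w := by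
  obtain ⟨b, hb⟩ := g.signature x
  refine ⟨∑ i, ((if i = 0 then -1 else 1) * α (b i)) • b i, fun w ↦ ?_⟩
  have key : (g.inner x (∑ i, ((if i = 0 then -1 else 1) * α (b i)) • b i) :
      TangentSpace (𝓡 (m + 1)) x →ₗ[ℝ] ℝ) = (α : TangentSpace (𝓡 (m + 1)) x →ₗ[ℝ] ℝ) := by
    refine b.ext fun j ↦ ?_
    simp only [ContinuousLinearMap.coe_coe, map_sum, map_smul, sum_apply,
      smul_apply, hb, smul_eq_mul, mul_ite, mul_zero, Finset.sum_ite_eq',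
      Finset.mem_univ, if_true]
    split_ifs <;> ring
  exact LinearMap.congr_fun key w

/-- The gradient of `f` at `x`: the unique vector with `⟨grad f, w⟩ = df(w)` for all `w`. -/
def grad (f : M → ℝ) (x : M) : TangentSpace (𝓡 (m + 1)) x :=
  (g.exists_inner_eq x (mfderiv (𝓡 (m + 1)) 𝓘(ℝ, ℝ) f x)).choose

theorem inner_grad (f : M → ℝ) (x : M) (w : TangentSpace (𝓡 (m + 1)) x) :
    g.inner x (g.grad f x) w = mfderiv (𝓡 (m + 1)) 𝓘(ℝ, ℝ) f x w :=
  (g.exists_inner_eq x (mfderiv (𝓡 (m + 1)) 𝓘(ℝ, ℝ) f x)).choose_spec w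

/-- Timelike tangent vectors. -/
def IsTimelike {x : M} (v : TangentSpace (𝓡 (m + 1)) x) : Prop :=
  g.inner x v v < 0

/-- `T` is a smooth timelike vector field; such a field determines a time orientation, in which a
nonzero non-spacelike vector `v` at `x` is future-pointing when `⟨v, T x⟩ < 0`. -/
def IsTimeOrientation (T : (x : M) → TangentSpace (𝓡 (m + 1)) x) : Prop :=
  ContMDiff (𝓡 (m + 1)) (𝓡 (m + 1)).tangent ∞
      (fun x ↦ (⟨x, T x⟩ : TangentBundle (𝓡 (m + 1)) M)) ∧
    ∀ x, g.IsTimelike (T x)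

/-- `v` is non-spacelike, and future-pointing for the time orientation of `T` if nonzero. -/
def IsFutureCausal (T : (x : M) → TangentSpace (𝓡 (m + 1)) x) {x : M}
    (v : TangentSpace (𝓡 (m + 1)) x) : Prop :=
  g.inner x v v ≤ 0 ∧ (v ≠ 0 → g.inner x v (T x) < 0)

/-- The restriction of `c` to the interval `s` is a smooth future-directed causal curve. -/
def IsFutureCausalCurve (T : (x : M) → TangentSpace (𝓡 (m + 1)) x) (c : ℝ → M)
    (s : Set ℝ) : Prop :=
  ContMDiffOn 𝓘(ℝ, ℝ) (𝓡 (m + 1)) ∞ c s ∧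
    ∀ u ∈ s, g.IsFutureCausal T
      (mfderivWithin 𝓘(ℝ, ℝ) (𝓡 (m + 1)) c s u (1 : TangentSpace 𝓘(ℝ, ℝ) u))

/-- The causal future `J⁺(p)`. -/
def causalFuture (T : (x : M) → TangentSpace (𝓡 (m + 1)) x) (p : M) : Set M :=
  {q | ∃ (c : ℝ → M) (a b : ℝ), a < b ∧ g.IsFutureCausalCurve T c (Icc a b) ∧
    c a = p ∧ c b = q}

/-- The causal past `J⁻(p)`: the causal future for the opposite time orientation. -/
def causalPast (T : (x : M) → TangentSpace (𝓡 (m + 1)) x) (p : M) : Set M :=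
  g.causalFuture (fun x ↦ -T x) p

/-- The past domain of dependence `D⁻(S)`: the points `p` such that any future-directed causal
curve `c : [a, b) → M` (possibly `b = +∞`) which starts at `p` and is future-inextendible, that is,
for which `lim_{u → b} c u` does not exist, intersects `S`. -/
def pastDomain (T : (x : M) → TangentSpace (𝓡 (m + 1)) x) (S : Set M) : Set M :=
  {p | ∀ (c : ℝ → M) (a : ℝ) (b : EReal), (a : EReal) < b →
    g.IsFutureCausalCurve T c {u : ℝ | a ≤ u ∧ (u : EReal) < b} → c a = p →
    (¬ ∃ q : M, Tendsto c (comap (fun u : ℝ ↦ (u : EReal)) (𝓝[<] b)) (𝓝 q)) →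
    ∃ u : ℝ, a ≤ u ∧ (u : EReal) < b ∧ c u ∈ S}

/-- The future domain of dependence `D⁺(S)`: the same with the opposite time orientation. -/
def futureDomain (T : (x : M) → TangentSpace (𝓡 (m + 1)) x) (S : Set M) : Set M :=
  g.pastDomain (fun x ↦ -T x) S

/-- The domain of dependence `D(S)`. -/
def domainOfDependence (T : (x : M) → TangentSpace (𝓡 (m + 1)) x) (S : Set M) : Set M :=
  g.futureDomain T S ∪ g.pastDomain T S

/-- A global time function: a smooth function with everywhere timelike gradient. -/
def IsTimeFunction (t : M → ℝ) : Prop :=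
  ContMDiff (𝓡 (m + 1)) 𝓘(ℝ, ℝ) ∞ t ∧ ∀ x, g.IsTimelike (g.grad t x)

/-- Stable causality: existence of a global time function. -/
def IsStablyCausal : Prop :=
  ∃ t : M → ℝ, g.IsTimeFunction t

/-- Global hyperbolicity: `M` is stably causal, and there is a time function `t` all of whose
(nonempty) time slices `S_a = t⁻¹(a)` have `D(S_a) = M`, for the time orientation of `-grad t`. -/
def IsGloballyHyperbolic : Prop :=
  g.IsStablyCausal ∧ ∃ t : M → ℝ, g.IsTimeFunction t ∧
    ∀ a ∈ range t, g.domainOfDependence (fun x ↦ -g.grad t x) (t ⁻¹' {a}) = univ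

end LorentzMetric

end

/-! Two ingredients carry the proof. Locally, the causal relation is closed: each point has a
compact neighbourhood `B` and a closed set `N` of pairs in `B ×ˢ B` that consists of causally
related pairs and contains the endpoints of every causal curve that stays in `B`
(`IsTimeFunction.exists_local_causal_relation`). In a chart, `N` is the set of pairs joined by a
short geodesic of nonpositive energy that is future-pointing at its end. Short geodesics come from a
contraction argument for the two-point boundary value problem. The energy `E(p, q)` of the geodesic
from `p` to `q` has `q`-derivative `2⟨P, ·⟩`, where `P` is the final velocity. Hence, once `P` is
future timelike, `E(p, c u)` decreases along a causal curve `c` and `P` stays future timelike.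

Globally, let `p` lie in the past domain of dependence of the slice `t = a`. Then the part of the
causal future of `p` with `t ≤ a` is compact (`IsTimeFunction.isCompact_causalFuture_inter`).
Otherwise some ultrafilter on this set has no limit in it. Let `L` be the set of points `x` such
that, for every neighbourhood of `x`, the ultrafilter concentrates on the future of that
neighbourhood. This set is closed, contains `p` and satisfies `t ≤ a`. The local relation and
compactness of the frontier of `B` show that from each point of `L` in the future of `p` one can
move causally to another point of `L` with larger `t`. Steps that gain at least half of the possible
increase of `arctan t` form a chain without limit, and so an inextendible causal curve from `p`
(`IsTimeFunction.exists_inextendible`). Every point of this curve has a point of `L` in its future.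
The curve meets the slice, so some point of `L` has `t ≥ a`, and one further step contradicts `t ≤
a` on `L`.

Closedness of the future follows by taking `a` above the value of `t` at a limit point. Compactness
of the intersection with a causal past follows by applying closedness to `-t` as well. The given
orientation agrees with that of `-grad t` or of `grad t` along each causal curve, so replacing `t`
by `-t` if necessary reduces it to the first case. -/

noncomputable section

/-! ### Two-point boundary value problems for second-order equations. -/

section BoundaryValue

variable {E : Type*} [NormedAddCommGroup E] [NormedSpace ℝ E]

/-- If `ξ'' = α` on `[0, 1]` and `‖α‖ ≤ A`, the velocity differs from the mean velocity by at
most `A`. -/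
theorem norm_velocity_sub_le {ξ ζ α : ℝ → E} {A : ℝ}
    (hξ : ∀ t ∈ Icc (0 : ℝ) 1, HasDerivWithinAt ξ (ζ t) (Icc 0 1) t)
    (hζ : ∀ t ∈ Icc (0 : ℝ) 1, HasDerivWithinAt ζ (α t) (Icc 0 1) t)
    (hA : ∀ t ∈ Icc (0 : ℝ) 1, ‖α t‖ ≤ A) {s : ℝ} (hs : s ∈ Icc (0 : ℝ) 1) :
    ‖ζ s - (ξ 1 - ξ 0)‖ ≤ A := by
  have hA0 : 0 ≤ A := (norm_nonneg _).trans (hA s hs)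
  have h1 : ∀ t ∈ Icc (0 : ℝ) 1, ‖ζ t - ζ s‖ ≤ A := by
    intro t ht
    refine ((convex_Icc (0 : ℝ) 1).norm_image_sub_le_of_norm_hasDerivWithin_le hζ hA hs ht).trans ?_
    have : ‖t - s‖ ≤ 1 := by
      rw [Real.norm_eq_abs, abs_le]
      constructor <;> linarith [ht.1, ht.2, hs.1, hs.2]
    nlinarith
  -- Subtracting the uniform motion with velocity `ζ s` leaves a curve of speed at most `A`.
  have h2 : ∀ t ∈ Icc (0 : ℝ) 1,
      HasDerivWithinAt (fun t ↦ ξ t - t • ζ s) (ζ t - ζ s) (Icc 0 1) t := by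
    intro t ht
    have h := (hasDerivWithinAt_id t (Icc (0 : ℝ) 1)).smul_const (ζ s)
    rw [one_smul] at h
    exact (hξ t ht).sub h
  have h3 := (convex_Icc (0 : ℝ) 1).norm_image_sub_le_of_norm_hasDerivWithin_le h2 h1
    (left_mem_Icc.2 zero_le_one) (right_mem_Icc.2 zero_le_one)
  have h4 : ζ s - (ξ 1 - ξ 0) = -(ξ 1 - (1 : ℝ) • ζ s - (ξ 0 - (0 : ℝ) • ζ s)) := by
    simp only [one_smul, zero_smul]
    abel
  rw [h4, norm_neg]
  simpa using h3

theorem norm_position_sub_le {ξ ζ : ℝ → E} {A : ℝ}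
    (hξ : ∀ t ∈ Icc (0 : ℝ) 1, HasDerivWithinAt ξ (ζ t) (Icc 0 1) t)
    (hA : ∀ t ∈ Icc (0 : ℝ) 1, ‖ζ t‖ ≤ A) {s : ℝ} (hs : s ∈ Icc (0 : ℝ) 1) :
    ‖ξ s - ξ 0‖ ≤ A := by
  have h3 := (convex_Icc (0 : ℝ) 1).norm_image_sub_le_of_norm_hasDerivWithin_le hξ hA
    (left_mem_Icc.2 zero_le_one) hs
  have : ‖s - 0‖ ≤ 1 := by
    rw [sub_zero, Real.norm_eq_abs, abs_le]
    constructor <;> linarith [hs.1, hs.2]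
  have hA0 : 0 ≤ A := (norm_nonneg _).trans (hA s hs)
  nlinarith

/-- `(γ, w)` solves `γ' = w`, `w' = f (γ, w)` on `[0, 1]`, with `γ` running from `p` to `q`. -/
structure IsArc (f : E × E → E) (p q : E) (γ w : ℝ → E) : Prop where
  pos : ∀ t ∈ Icc (0 : ℝ) 1, HasDerivWithinAt γ (w t) (Icc 0 1) t
  vel : ∀ t ∈ Icc (0 : ℝ) 1, HasDerivWithinAt w (f (γ t, w t)) (Icc 0 1) t
  left : γ 0 = p
  right : γ 1 = q

theorem IsArc.continuousOn {f : E × E → E} {p q : E} {γ w : ℝ → E} (h : IsArc f p q γ w) :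
    ContinuousOn (fun t ↦ (γ t, w t)) (Icc 0 1) := fun t ht ↦
  (h.pos t ht).continuousWithinAt.prodMk (h.vel t ht).continuousWithinAt

/-- Two solutions of the boundary value problem stay close when their boundary values are. -/
theorem IsArc.norm_sub_le {f : E × E → E} {s : Set (E × E)} {K : NNReal}
    (hf : LipschitzOnWith K f s) (hK : (K : ℝ) ≤ 1 / 2) {p q p' q' : E} {γ w γ' w' : ℝ → E}
    (h : IsArc f p q γ w) (h' : IsArc f p' q' γ' w')
    (hs : ∀ t ∈ Icc (0 : ℝ) 1, (γ t, w t) ∈ s) (hs' : ∀ t ∈ Icc (0 : ℝ) 1, (γ' t, w' t) ∈ s)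
    {t : ℝ} (ht : t ∈ Icc (0 : ℝ) 1) :
    ‖(w t - w' t) - ((q - q') - (p - p'))‖ ≤ 2 * K * (‖p - p'‖ + ‖(q - q') - (p - p')‖) := by
  have hcont : ContinuousOn (fun t ↦ ‖f (γ t, w t) - f (γ' t, w' t)‖) (Icc 0 1) :=
    ((hf.continuousOn.comp h.continuousOn hs).sub
      (hf.continuousOn.comp h'.continuousOn hs')).norm
  obtain ⟨t₀, ht₀, hmax⟩ := isCompact_Icc.exists_isMaxOn ⟨t, ht⟩ hcont
  set A := ‖f (γ t₀, w t₀) - f (γ' t₀, w' t₀)‖ with hAdef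
  have hA : ∀ t ∈ Icc (0 : ℝ) 1, ‖f (γ t, w t) - f (γ' t, w' t)‖ ≤ A := fun t ht ↦ hmax ht
  have hvel : ∀ t ∈ Icc (0 : ℝ) 1, ‖(w t - w' t) - ((q - q') - (p - p'))‖ ≤ A := by
    intro t ht
    have := norm_velocity_sub_le (ξ := fun t ↦ γ t - γ' t) (ζ := fun t ↦ w t - w' t)
      (fun t ht ↦ (h.pos t ht).sub (h'.pos t ht)) (fun t ht ↦ (h.vel t ht).sub (h'.vel t ht)) hA ht
    simpa only [h.left, h.right, h'.left, h'.right] using this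
  set D := ‖p - p'‖ + ‖(q - q') - (p - p')‖ with hD
  have hw : ∀ t ∈ Icc (0 : ℝ) 1, ‖w t - w' t‖ ≤ ‖(q - q') - (p - p')‖ + A := by
    intro t ht
    have := norm_add_le ((w t - w' t) - ((q - q') - (p - p'))) ((q - q') - (p - p'))
    rw [sub_add_cancel] at this
    linarith [hvel t ht]
  have hγ : ∀ t ∈ Icc (0 : ℝ) 1, ‖γ t - γ' t‖ ≤ D + A := by
    intro t ht
    have h1 := norm_position_sub_le (ξ := fun t ↦ γ t - γ' t) (ζ := fun t ↦ w t - w' t)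
      (fun t ht ↦ (h.pos t ht).sub (h'.pos t ht)) hw ht
    simp only [h.left, h'.left] at h1
    have := norm_add_le ((γ t - γ' t) - (p - p')) (p - p')
    rw [sub_add_cancel] at this
    linarith
  -- `K ≤ 1 / 2` lets the right-hand `A` be absorbed, giving `A ≤ 2 * K * D`.
  have hAle : A ≤ K * (D + A) := by
    refine (hf.norm_sub_le (hs t₀ ht₀) (hs' t₀ ht₀)).trans ?_
    gcongr
    rw [Prod.norm_def]
    refine max_le (hγ t₀ ht₀) ((hw t₀ ht₀).trans ?_)
    linarith [norm_nonneg (p - p')]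
  have hA0 : 0 ≤ A := norm_nonneg _
  have hK0 : (0 : ℝ) ≤ K := K.2
  refine (hvel t ht).trans ?_
  nlinarith

/-- A boundary value problem for a second order equation whose right-hand side has a small
Lipschitz constant is solvable. -/
theorem exists_isArc [CompleteSpace E] {f : E × E → E} {K : NNReal} (hf : LipschitzWith K f)
    (hK : K < 1) (p q : E) : ∃ γ w : ℝ → E, IsArc f p q γ w := by
  let ext : C(Icc (0 : ℝ) 1, E) → ℝ → E := fun a t ↦ a (projIcc 0 1 zero_le_one t)
  have hext : ∀ a, Continuous (ext a) := fun a ↦ a.continuous.comp continuous_projIcc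
  let I : (ℝ → E) → ℝ → E := fun u t ↦ ∫ s in (0 : ℝ)..t, u s
  have hI : ∀ u, Continuous u → ∀ t, HasDerivAt (I u) (u t) t := fun u hu t ↦
    intervalIntegral.integral_hasDerivAt_right (hu.intervalIntegrable _ _)
      (hu.stronglyMeasurableAtFilter _ _) hu.continuousAt
  have hIc : ∀ u, Continuous u → Continuous (I u) := fun u hu ↦
    continuous_iff_continuousAt.2 fun t ↦ (hI u hu t).continuousAt
  -- The unknown is the acceleration `a`. Velocity `W a` and position `Γ a` are its integrals, with
  -- initial velocity chosen so that `Γ a 1 = q`. For two accelerations the difference of positions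
  -- vanishes at both ends, so positions and velocities differ by at most `dist a b`, and `Φ`
  -- inherits the Lipschitz constant `K`.
  let W : C(Icc (0 : ℝ) 1, E) → ℝ → E := fun a t ↦ (q - p) - I (I (ext a)) 1 + I (ext a) t
  let Γ : C(Icc (0 : ℝ) 1, E) → ℝ → E := fun a t ↦
    p + (t • ((q - p) - I (I (ext a)) 1) + I (I (ext a)) t)
  have hW : ∀ a t, HasDerivAt (W a) (ext a t) t := fun a t ↦ (hI _ (hext a) t).const_add _
  have hΓ : ∀ a t, HasDerivAt (Γ a) (W a t) t := fun a t ↦ by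
    have h1 := (hasDerivAt_id t).smul_const ((q - p) - I (I (ext a)) 1)
    rw [one_smul] at h1
    exact (h1.add (hI _ (hIc _ (hext a)) t)).const_add p
  have hI0 : ∀ u, I u 0 = 0 := fun u ↦ intervalIntegral.integral_same
  have hΓ0 : ∀ a, Γ a 0 = p := fun a ↦ by simp [Γ, hI0]
  have hΓ1 : ∀ a, Γ a 1 = q := fun a ↦ by simp [Γ]
  let Φ : C(Icc (0 : ℝ) 1, E) → C(Icc (0 : ℝ) 1, E) := fun a ↦
    ⟨fun t ↦ f (Γ a t, W a t), hf.continuous.comp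
      (((continuous_iff_continuousAt.2 fun t ↦ (hΓ a t).continuousAt).comp
        continuous_subtype_val).prodMk ((continuous_iff_continuousAt.2
          fun t ↦ (hW a t).continuousAt).comp continuous_subtype_val))⟩
  have hΦ : ContractingWith K Φ := by
    refine ⟨hK, LipschitzWith.of_dist_le_mul fun a b ↦ ?_⟩
    have hab : ∀ t ∈ Icc (0 : ℝ) 1, ‖ext a t - ext b t‖ ≤ dist a b := fun t _ ↦ by
      rw [← dist_eq_norm]
      exact ContinuousMap.dist_apply_le_dist _
    have hw : ∀ t ∈ Icc (0 : ℝ) 1, ‖W a t - W b t‖ ≤ dist a b := fun t ht ↦ by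
      have := norm_velocity_sub_le (ξ := fun t ↦ Γ a t - Γ b t) (ζ := fun t ↦ W a t - W b t)
        (fun t _ ↦ ((hΓ a t).sub (hΓ b t)).hasDerivWithinAt)
        (fun t _ ↦ ((hW a t).sub (hW b t)).hasDerivWithinAt) hab ht
      simpa [hΓ0, hΓ1] using this
    have hγ : ∀ t ∈ Icc (0 : ℝ) 1, ‖Γ a t - Γ b t‖ ≤ dist a b := fun t ht ↦ by
      have := norm_position_sub_le (ξ := fun t ↦ Γ a t - Γ b t) (ζ := fun t ↦ W a t - W b t)
        (fun t _ ↦ ((hΓ a t).sub (hΓ b t)).hasDerivWithinAt) hw ht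
      simpa [hΓ0] using this
    refine (ContinuousMap.dist_le (by positivity)).2 fun t ↦ ?_
    refine (hf.dist_le_mul _ _).trans ?_
    gcongr
    rw [Prod.dist_eq, dist_eq_norm, dist_eq_norm]
    exact max_le (hγ t t.2) (hw t t.2)
  set a := hΦ.fixedPoint
  have ha : Φ a = a := hΦ.fixedPoint_isFixedPt
  refine ⟨Γ a, W a, fun t _ ↦ (hΓ a t).hasDerivWithinAt, fun t ht ↦ ?_, hΓ0 a, hΓ1 a⟩
  have h1 : f (Γ a t, W a t) = ext a t := by
    change Φ a ⟨t, ht⟩ = a (projIcc 0 1 zero_le_one t)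
    rw [ha, projIcc_of_mem _ ht]
  rw [h1]
  exact (hW a t).hasDerivWithinAt

end BoundaryValue

section BoundaryValueLocal

variable {E : Type*} [NormedAddCommGroup E] [NormedSpace ℝ E]

theorem isArc_const {f : E × E → E} {p : E} (h : f (p, 0) = 0) :
    IsArc f p p (fun _ ↦ p) (fun _ ↦ 0) :=
  ⟨fun t _ ↦ hasDerivWithinAt_const t _ p, fun t _ ↦ by
    rw [h]; exact hasDerivWithinAt_const t _ 0, rfl, rfl⟩

/-- ODE regularity for the first-order system in `(γ, w)`. It is needed because causal curves are
smooth by definition. -/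
theorem IsArc.contDiffOn [CompleteSpace E] {f : E × E → E} {U : Set (E × E)} (hf : ContDiffOn ℝ ∞ f U)
    {p q : E} {γ w : ℝ → E} (h : IsArc f p q γ w) (hU : ∀ t ∈ Icc (0 : ℝ) 1, (γ t, w t) ∈ U) :
    ContDiffOn ℝ ∞ γ (Icc 0 1) := by
  have h1 : ContDiffOn ℝ ∞ (Function.uncurry fun (_ : ℝ) (z : E × E) ↦ (z.2, f z))
      (Icc (0 : ℝ) 1 ×ˢ U) := by
    have h2 : ContDiffOn ℝ ∞ (fun z : ℝ × E × E ↦ f z.2) (Icc (0 : ℝ) 1 ×ˢ U) :=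
      hf.comp contDiff_snd.contDiffOn fun z hz ↦ hz.2
    exact contDiff_snd.snd.contDiffOn.prodMk h2
  have h3 := ODE.contDiffOn_enat_Icc_of_hasDerivWithinAt (n := ⊤) h1
    (α := fun t ↦ (γ t, w t)) (fun t ht ↦ (h.pos t ht).prodMk (h.vel t ht)) hU
  exact h3.fst

/-- Local solvability of the boundary value problem, with Lipschitz dependence on the data. -/
theorem exists_isArc_family [FiniteDimensional ℝ E] {f : E × E → E} {y : E}
    (hf : HasStrictFDerivAt f (0 : E × E →L[ℝ] E) (y, 0)) (hf0 : ∀ᶠ x in 𝓝 y, f (x, 0) = 0)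
    {κ δ : ℝ} (hκ : 0 < κ) (hδ : 0 < δ) :
    ∃ r > 0, ∃ γ w : E → E → ℝ → E, ∀ p ∈ Metric.ball y r, ∀ q ∈ Metric.ball y r,
      IsArc f p q (γ p q) (w p q) ∧
      (∀ t ∈ Icc (0 : ℝ) 1, (γ p q t, w p q t) ∈ Metric.ball (y, (0 : E)) δ ∧
        ‖w p q t - (q - p)‖ ≤ κ * ‖q - p‖) ∧
      ∀ p' ∈ Metric.ball y r, ∀ q' ∈ Metric.ball y r, ∀ t ∈ Icc (0 : ℝ) 1,
        ‖γ p q t - γ p' q' t‖ ≤ 3 * (‖p - p'‖ + ‖q - q'‖) ∧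
        ‖w p q t - w p' q' t‖ ≤ 2 * (‖p - p'‖ + ‖q - q'‖) := by
  have hcomplete : CompleteSpace E := FiniteDimensional.complete ℝ E
  set c := lipschitzExtensionConstant E
  have hc : 0 < c := lipschitzExtensionConstant_pos E
  -- The bound `κ / 2` serves the velocity estimate, and `1 / 4` the contraction and the numerical
  -- constants. Extending a Lipschitz map to all of `E × E` costs the factor `c`, so the constant `k
  -- / c` is requested near `(y, 0)`.
  obtain ⟨k, hk⟩ : ∃ k : NNReal, k = min (1 / 4) (κ / 2).toNNReal := ⟨_, rfl⟩
  have hk0 : 0 < k := by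
    rw [hk]
    exact lt_min (by norm_num) (by simpa using hκ)
  have hk4 : (k : ℝ) ≤ 1 / 4 := by
    have : k ≤ 1 / 4 := hk ▸ min_le_left _ _
    exact_mod_cast this
  have hkκ : 2 * (k : ℝ) ≤ κ := by
    have h1 : k ≤ (κ / 2).toNNReal := hk ▸ min_le_right _ _
    have h2 : (k : ℝ) ≤ κ / 2 := (Real.le_toNNReal_iff_coe_le (by positivity)).1 h1
    linarith
  obtain ⟨s, hs, hLs⟩ := hf.exists_lipschitzOnWith_of_nnnorm_lt (k / c) (by simpa using div_pos hk0 hc)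
  obtain ⟨g, hg, hgs⟩ := hLs.extend_finite_dimension
  rw [show c * (k / c) = k by field_simp] at hg
  obtain ⟨δ₁, hδ₁, hδs⟩ := Metric.mem_nhds_iff.1 hs
  obtain ⟨δ₂, hδ₂, hf00⟩ := Metric.eventually_nhds_iff.1 hf0
  obtain ⟨d, hd0, hd1, hd2, hd⟩ : ∃ d > 0, d ≤ δ₁ ∧ d ≤ δ₂ ∧ d ≤ δ :=
    ⟨min δ₁ (min δ₂ δ), by positivity, min_le_left _ _,
      (min_le_right _ _).trans (min_le_left _ _), (min_le_right _ _).trans (min_le_right _ _)⟩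
  have hfg : ∀ z ∈ Metric.ball (y, (0 : E)) d, f z = g z := fun z hz ↦
    hgs (hδs (Metric.ball_subset_ball hd1 hz))
  have hg0 : ∀ x ∈ Metric.ball y d, g (x, 0) = 0 := fun x hx ↦ by
    rw [← hfg, hf00 (lt_of_lt_of_le hx hd2)]
    rw [Metric.mem_ball, Prod.dist_eq]
    simpa [hd0] using hx
  have hk1 : k < 1 := by
    have : (k : ℝ) < 1 := by linarith
    exact_mod_cast this
  choose γ w harc using fun p q ↦ exists_isArc hg hk1 p q
  have hgu : LipschitzOnWith k g univ := hg.lipschitzOnWith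
  have hkh : (k : ℝ) ≤ 1 / 2 := by linarith
  have hkn : (0 : ℝ) ≤ k := k.2
  have hlip : ∀ p q p' q', ∀ t ∈ Icc (0 : ℝ) 1, ‖w p q t - w p' q' t‖ ≤ 2 * (‖p - p'‖ + ‖q - q'‖) := by
    intro p q p' q' t ht
    have h1 := (harc p q).norm_sub_le hgu hkh (harc p' q') (fun _ _ ↦ mem_univ _)
      (fun _ _ ↦ mem_univ _) ht
    have h2 := norm_add_le ((w p q t - w p' q' t) - ((q - q') - (p - p'))) ((q - q') - (p - p'))
    rw [sub_add_cancel] at h2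
    have h3 := norm_sub_le (q - q') (p - p')
    nlinarith [norm_nonneg (p - p'), norm_nonneg ((q - q') - (p - p')), norm_nonneg (q - q')]
  have hlip' : ∀ p q p' q', ∀ t ∈ Icc (0 : ℝ) 1,
      ‖γ p q t - γ p' q' t‖ ≤ 3 * (‖p - p'‖ + ‖q - q'‖) := by
    intro p q p' q' t ht
    have h1 := norm_position_sub_le (ξ := fun t ↦ γ p q t - γ p' q' t)
      (ζ := fun t ↦ w p q t - w p' q' t)
      (fun t ht ↦ ((harc p q).pos t ht).sub ((harc p' q').pos t ht)) (hlip p q p' q') ht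
    simp only [(harc p q).left, (harc p' q').left] at h1
    have h2 := norm_add_le ((γ p q t - γ p' q' t) - (p - p')) (p - p')
    rw [sub_add_cancel] at h2
    linarith [norm_nonneg (q - q')]
  -- With data within `d / 8` of `y`, velocities are at most `d / 2` and positions stay within `5 *
  -- d / 8` of `y`. There the extension `g` agrees with `f`.
  refine ⟨d / 8, by positivity, γ, w, fun p hp q hq ↦ ?_⟩
  have hp' : ‖p - y‖ < d / 8 := by rwa [← dist_eq_norm]
  have hq' : ‖q - y‖ < d / 8 := by rwa [← dist_eq_norm]
  have hball : ∀ t ∈ Icc (0 : ℝ) 1, (γ p q t, w p q t) ∈ Metric.ball (y, (0 : E)) d := by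
    intro t ht
    have hy := isArc_const (hg0 y (Metric.mem_ball_self hd0))
    have h1 : ∀ t ∈ Icc (0 : ℝ) 1, ‖w p q t‖ ≤ 4 * (d / 8) := fun t ht ↦ by
      have h1 := (harc p q).norm_sub_le hgu hkh hy (fun _ _ ↦ mem_univ _)
        (fun _ _ ↦ mem_univ _) ht
      rw [sub_zero] at h1
      have h2 := norm_add_le (w p q t - ((q - y) - (p - y))) ((q - y) - (p - y))
      rw [sub_add_cancel] at h2
      have h3 := norm_sub_le (q - y) (p - y)
      nlinarith [norm_nonneg (p - y), norm_nonneg ((q - y) - (p - y)), norm_nonneg (q - y)]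
    have h2 := norm_position_sub_le (harc p q).pos h1 ht
    rw [(harc p q).left] at h2
    have h3 := norm_add_le (γ p q t - p) (p - y)
    rw [sub_add_sub_cancel] at h3
    rw [Metric.mem_ball, Prod.dist_eq, dist_eq_norm, dist_eq_norm]
    refine max_lt (by linarith) ?_
    simpa using lt_of_le_of_lt (h1 t ht) (by linarith)
  refine ⟨⟨(harc p q).pos, fun t ht ↦ ?_, (harc p q).left, (harc p q).right⟩, fun t ht ↦
    ⟨Metric.ball_subset_ball hd (hball t ht), ?_⟩, fun p' _ q' _ t ht ↦
    ⟨hlip' p q p' q' t ht, hlip p q p' q' t ht⟩⟩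
  · rw [hfg _ (hball t ht)]
    exact (harc p q).vel t ht
  -- Comparison with the constant arc at `p`, so that only `q - p` enters the bound.
  · have h1 := (harc p q).norm_sub_le hgu hkh (isArc_const (hg0 p
      (Metric.ball_subset_ball (by linarith) hp))) (fun _ _ ↦ mem_univ _)
        (fun _ _ ↦ mem_univ _) ht
    simp only [sub_zero, sub_self, norm_zero, zero_add] at h1
    refine h1.trans ?_
    gcongr

end BoundaryValueLocal

/-! ### Geodesics and the first variation of energy in a chart. -/

section Geodesic

set_option maxSynthPendingDepth 3

variable {E : Type*} [NormedAddCommGroup E] [NormedSpace ℝ E]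

/-- A smooth field of nondegenerate symmetric bilinear forms on the open set `Ω`. -/
structure IsFlatMetric (G : E → E →L[ℝ] E →L[ℝ] ℝ) (Ω : Set E) : Prop where
  isOpen : IsOpen Ω
  contDiffOn : ContDiffOn ℝ ∞ G Ω
  symm : ∀ x ∈ Ω, ∀ v w, G x v w = G x w v
  nondeg : ∀ x ∈ Ω, ∀ v, (∀ w, G x v w = 0) → v = 0

/-- The covector `ξ ↦ ½ (D_ξ G)(w, w) - (D_w G)(w, ξ)`. -/
def geodesicForce (G : E → E →L[ℝ] E →L[ℝ] ℝ) (z : E × E) : E →L[ℝ] ℝ :=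
  (1 / 2 : ℝ) • ((fderiv ℝ G z.1).flip z.2).flip z.2 - fderiv ℝ G z.1 z.2 z.2

/-- The acceleration of the geodesic of `G` with position `z.1` and velocity `z.2`. -/
def geodesicAccel (G : E → E →L[ℝ] E →L[ℝ] ℝ) (z : E × E) : E :=
  (G z.1).inverse (geodesicForce G z)

theorem geodesicForce_apply (G : E → E →L[ℝ] E →L[ℝ] ℝ) (x w ξ : E) :
    geodesicForce G (x, w) ξ = 1 / 2 * fderiv ℝ G x ξ w w - fderiv ℝ G x w w ξ := rfl

theorem geodesicForce_smul (G : E → E →L[ℝ] E →L[ℝ] ℝ) (x w : E) (s : ℝ) :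
    geodesicForce G (x, s • w) = (s * s) • geodesicForce G (x, w) := by
  ext ξ
  simp only [geodesicForce_apply, map_smul, smul_apply, smul_eq_mul]
  ring

theorem geodesicAccel_smul (G : E → E →L[ℝ] E →L[ℝ] ℝ) (x w : E) (s : ℝ) :
    geodesicAccel G (x, s • w) = (s * s) • geodesicAccel G (x, w) := by
  simp only [geodesicAccel, geodesicForce_smul, map_smul]

theorem geodesicAccel_zero (G : E → E →L[ℝ] E →L[ℝ] ℝ) (x : E) : geodesicAccel G (x, 0) = 0 := by
  simpa using geodesicAccel_smul G x 0 0

namespace IsFlatMetric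

variable {G : E → E →L[ℝ] E →L[ℝ] ℝ} {Ω : Set E}

theorem contDiffAt (h : IsFlatMetric G Ω) {x : E} (hx : x ∈ Ω) : ContDiffAt ℝ ∞ G x :=
  h.contDiffOn.contDiffAt (h.isOpen.mem_nhds hx)

theorem hasFDerivAt (h : IsFlatMetric G Ω) {x : E} (hx : x ∈ Ω) :
    HasFDerivAt G (fderiv ℝ G x) x :=
  ((h.contDiffAt hx).differentiableAt (by simp)).hasFDerivAt

theorem isInvertible [FiniteDimensional ℝ E] (h : IsFlatMetric G Ω) {x : E} (hx : x ∈ Ω) :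
    (G x).IsInvertible := by
  have hinj : Function.Injective (G x).toLinearMap := by
    rw [← LinearMap.ker_eq_bot, LinearMap.ker_eq_bot']
    intro v hv
    exact h.nondeg x hx v fun w ↦ by
      have : G x v = 0 := hv
      simp [this]
  have hfin : Module.finrank ℝ E = Module.finrank ℝ (E →L[ℝ] ℝ) := by
    rw [← (LinearMap.toContinuousLinearMap (𝕜 := ℝ) (E := E) (F' := ℝ)).finrank_eq,
      ← Subspace.dual_finrank_eq (K := ℝ) (V := E)]
  refine ⟨(LinearEquiv.ofInjectiveOfFinrankEq (G x).toLinearMap hinj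
    hfin).toContinuousLinearEquiv, ?_⟩
  ext v w
  rfl

/-- The Euler–Lagrange equation of the energy, tested against `ξ`. In this weak form no Christoffel
symbols are needed. -/
theorem apply_geodesicAccel [FiniteDimensional ℝ E] (h : IsFlatMetric G Ω) {x : E} (hx : x ∈ Ω)
    (w ξ : E) :
    G x (geodesicAccel G (x, w)) ξ = 1 / 2 * fderiv ℝ G x ξ w w - fderiv ℝ G x w w ξ := by
  rw [← geodesicForce_apply, geodesicAccel]
  obtain ⟨e, he⟩ := h.isInvertible hx
  simp only [← he, ContinuousLinearMap.inverse_equiv]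
  simp

theorem contDiffOn_geodesicAccel [FiniteDimensional ℝ E] (h : IsFlatMetric G Ω) :
    ContDiffOn ℝ ∞ (geodesicAccel G) (Ω ×ˢ univ) := by
  have hc : CompleteSpace E := FiniteDimensional.complete ℝ E
  have hD : ContDiffOn ℝ ∞ (fun z : E × E ↦ fderiv ℝ G z.1) (Ω ×ˢ univ) :=
    (h.contDiffOn.fderiv_of_isOpen h.isOpen (m := ∞) (by simp)).comp contDiff_fst.contDiffOn
      fun z hz ↦ hz.1
  have hβ : ContDiffOn ℝ ∞ (geodesicForce G) (Ω ×ˢ univ) := by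
    rw [contDiffOn_clm_apply]
    intro ξ
    have h1 : ContDiffOn ℝ ∞ (fun z : E × E ↦
        1 / 2 * fderiv ℝ G z.1 ξ z.2 z.2 - fderiv ℝ G z.1 z.2 z.2 ξ) (Ω ×ˢ univ) := by
      have hs : ContDiffOn ℝ ∞ (fun z : E × E ↦ z.2) (Ω ×ˢ univ) := contDiff_snd.contDiffOn
      have hk : ContDiffOn ℝ ∞ (fun _ : E × E ↦ ξ) (Ω ×ˢ univ) := contDiffOn_const
      exact (contDiffOn_const.mul (((hD.clm_apply hk).clm_apply hs).clm_apply hs)).sub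
        (((hD.clm_apply hs).clm_apply hs).clm_apply hk)
    exact h1
  have hinv : ContDiffOn ℝ ∞ (fun z : E × E ↦ (G z.1).inverse) (Ω ×ˢ univ) := by
    intro z hz
    exact ((h.isInvertible hz.1).contDiffAt_map_inverse.comp z
      ((h.contDiffAt hz.1).comp z contDiffAt_fst)).contDiffWithinAt
  exact hinv.clm_apply hβ

/-- The acceleration vanishes on zero velocities and is quadratic in the velocity, so both partial
derivatives vanish. This provides the small Lipschitz constant that the boundary value problem
requires. -/
theorem hasStrictFDerivAt_geodesicAccel [FiniteDimensional ℝ E] (h : IsFlatMetric G Ω) {y : E}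
    (hy : y ∈ Ω) : HasStrictFDerivAt (geodesicAccel G) (0 : E × E →L[ℝ] E) (y, 0) := by
  have h1 : ContDiffAt ℝ ∞ (geodesicAccel G) (y, 0) := h.contDiffOn_geodesicAccel.contDiffAt
    ((h.isOpen.prod isOpen_univ).mem_nhds ⟨hy, mem_univ _⟩)
  have h2 := h1.hasStrictFDerivAt (by simp)
  suffices h0 : fderiv ℝ (geodesicAccel G) (y, 0) = 0 by rwa [h0] at h2
  ext1
  · ext ξ
    have h3 : HasFDerivAt (fun x : E ↦ (x, (0 : E))) (ContinuousLinearMap.inl ℝ E E) y :=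
      (hasFDerivAt_id y).prodMk (hasFDerivAt_const 0 y)
    have h4 := HasFDerivAt.comp (f := fun x : E ↦ (x, (0 : E))) y h2.hasFDerivAt h3
    have h5 : geodesicAccel G ∘ (fun x : E ↦ (x, (0 : E))) = fun _ ↦ 0 :=
      funext fun x ↦ geodesicAccel_zero G x
    rw [h5] at h4
    exact congrArg (fun A ↦ A ξ) (h4.unique (hasFDerivAt_const (0 : E) y))
  · ext η
    have h3 : HasDerivAt (fun s : ℝ ↦ (y, s • η)) ((0 : E), η) 0 := by
      have := (hasDerivAt_const (0 : ℝ) y).prodMk ((hasDerivAt_id (0 : ℝ)).smul_const η)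
      simpa using this
    have h4 := HasFDerivAt.comp_hasDerivAt_of_eq (f := fun s : ℝ ↦ (y, s • η)) (0 : ℝ)
      h2.hasFDerivAt h3 (by rw [zero_smul])
    have h5 : geodesicAccel G ∘ (fun s : ℝ ↦ (y, s • η)) =
        fun s ↦ (s * s) • geodesicAccel G (y, η) :=
      funext fun s ↦ geodesicAccel_smul G y η s
    rw [h5] at h4
    have h6 := ((hasDerivAt_id (0 : ℝ)).mul (hasDerivAt_id (0 : ℝ))).smul_const
      (geodesicAccel G (y, η))
    have h7 := h4.unique h6
    simpa using h7

theorem hasDerivWithinAt_apply (h : IsFlatMetric G Ω) {γ γ' u u' v v' : ℝ → E} {s : Set ℝ} {t : ℝ}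
    (hγt : γ t ∈ Ω) (hγ : HasDerivWithinAt γ (γ' t) s t) (hu : HasDerivWithinAt u (u' t) s t)
    (hv : HasDerivWithinAt v (v' t) s t) :
    HasDerivWithinAt (fun t ↦ G (γ t) (u t) (v t))
      (fderiv ℝ G (γ t) (γ' t) (u t) (v t) + G (γ t) (u' t) (v t) + G (γ t) (u t) (v' t)) s t :=
  (((h.hasFDerivAt hγt).comp_hasDerivWithinAt t hγ).clm_apply hu).clm_apply hv

/-- Geodesics have constant energy. -/
theorem energy_eq [FiniteDimensional ℝ E] (h : IsFlatMetric G Ω) {p q : E} {γ w : ℝ → E}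
    (ha : IsArc (geodesicAccel G) p q γ w) (hΩ : ∀ t ∈ Icc (0 : ℝ) 1, γ t ∈ Ω)
    {t : ℝ} (ht : t ∈ Icc (0 : ℝ) 1) : G (γ t) (w t) (w t) = G q (w 1) (w 1) := by
  have h1 : ∀ t ∈ Icc (0 : ℝ) 1,
      HasDerivWithinAt (fun t ↦ G (γ t) (w t) (w t)) 0 (Icc 0 1) t := by
    intro t ht
    convert h.hasDerivWithinAt_apply (γ' := w) (u' := fun t ↦ geodesicAccel G (γ t, w t))
      (v' := fun t ↦ geodesicAccel G (γ t, w t)) (hΩ t ht) (ha.pos t ht) (ha.vel t ht)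
      (ha.vel t ht) using 1
    -- Testing the geodesic equation with `ξ = w` makes the two acceleration terms cancel the
    -- derivative of the metric.
    rw [h.symm _ (hΩ t ht) (w t) (geodesicAccel G _), h.apply_geodesicAccel (hΩ t ht)]
    ring
  have h2 := (convex_Icc (0 : ℝ) 1).norm_image_sub_le_of_norm_hasDerivWithin_le (C := 0) h1
    (by simp) (right_mem_Icc.2 zero_le_one) ht
  simp only [zero_mul, norm_le_zero_iff, sub_eq_zero, ha.right] at h2
  exact h2

/-- The energy density `(x, w) ↦ G x w w` has second order Taylor estimates near `(y, 0)`. -/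
theorem exists_energy_taylor (h : IsFlatMetric G Ω) {y : E} (hy : y ∈ Ω) :
    ∃ δ > 0, ∃ C : ℝ, Metric.ball y δ ⊆ Ω ∧
      ∀ z ∈ Metric.ball (y, (0 : E)) δ, ∀ z' ∈ Metric.ball (y, (0 : E)) δ,
        |G z'.1 z'.2 z'.2 - G z.1 z.2 z.2 - (fderiv ℝ G z.1 (z'.1 - z.1) z.2 z.2 +
          2 * G z.1 z.2 (z'.2 - z.2))| ≤ C * ‖z' - z‖ ^ 2 := by
  set L : E × E → ℝ := fun z ↦ G z.1 z.2 z.2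
  have hL : ContDiffOn ℝ ∞ L (Ω ×ˢ univ) :=
    ((h.contDiffOn.comp contDiff_fst.contDiffOn fun z hz ↦ hz.1).clm_apply
      contDiff_snd.contDiffOn).clm_apply contDiff_snd.contDiffOn
  have hop : IsOpen (Ω ×ˢ (univ : Set E)) := h.isOpen.prod isOpen_univ
  have hDL : ContDiffAt ℝ 1 (fderiv ℝ L) (y, 0) :=
    ((hL.fderiv_of_isOpen hop (m := ∞) (by simp)).contDiffAt
      (hop.mem_nhds ⟨hy, mem_univ _⟩)).of_le (by simp)
  obtain ⟨C, s, hs, hC⟩ := hDL.exists_lipschitzOnWith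
  obtain ⟨δ, hδ, hδs⟩ := Metric.mem_nhds_iff.1
    (inter_mem hs (hop.mem_nhds ⟨hy, mem_univ (0 : E)⟩))
  refine ⟨δ, hδ, C, fun x hx ↦ ?_, fun z hz z' hz' ↦ ?_⟩
  · have : (x, (0 : E)) ∈ Metric.ball (y, (0 : E)) δ := by
      rw [Metric.mem_ball, Prod.dist_eq]
      simpa [hδ] using hx
    exact (hδs this).2.1
  · have hzΩ : z.1 ∈ Ω := (hδs hz).2.1
    have hfd : ∀ ζ : E × E, fderiv ℝ L z ζ =
        fderiv ℝ G z.1 ζ.1 z.2 z.2 + 2 * G z.1 z.2 ζ.2 := by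
      intro ζ
      have h1 := HasFDerivAt.comp z (h.hasFDerivAt hzΩ) (hasFDerivAt_fst (p := z))
      have h2 : HasFDerivAt L _ z := (h1.clm_apply hasFDerivAt_snd).clm_apply hasFDerivAt_snd
      rw [h2.fderiv]
      simp [h.symm _ hzΩ ζ.2 z.2]
      ring
    rw [← Prod.fst_sub, ← Prod.snd_sub, ← hfd]
    have h3 : ∀ ζ ∈ segment ℝ z z', HasFDerivWithinAt L (fderiv ℝ L ζ) (segment ℝ z z') ζ := by
      intro ζ hζ
      have : ζ ∈ Ω ×ˢ (univ : Set E) := (hδs ((convex_ball _ _).segment_subset hz hz' hζ)).2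
      exact ((hL.contDiffAt (hop.mem_nhds this)).differentiableAt
        (by simp)).hasFDerivAt.hasFDerivWithinAt
    have h4 : ∀ ζ ∈ segment ℝ z z', ‖fderiv ℝ L ζ - fderiv ℝ L z‖ ≤ C * ‖z' - z‖ := by
      intro ζ hζ
      refine (hC.norm_sub_le (hδs ((convex_ball _ _).segment_subset hz hz' hζ)).1
        (hδs hz).1).trans ?_
      gcongr
      obtain ⟨a, b, ha, hb, hab, rfl⟩ := hζ
      have : a • z + b • z' - z = b • (z' - z) := by
        rw [← eq_sub_iff_add_eq] at hab
        rw [hab]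
        module
      rw [this, norm_smul, Real.norm_of_nonneg hb]
      nlinarith [norm_nonneg (z' - z)]
    have h5 := (convex_segment z z').norm_image_sub_le_of_norm_hasFDerivWithin_le' h3 h4
      (left_mem_segment ℝ z z') (right_mem_segment ℝ z z')
    rw [Real.norm_eq_abs] at h5
    calc _ ≤ _ := h5
      _ = _ := by ring

/-- First variation of the energy, in quantitative form. -/
theorem abs_energy_sub_le [FiniteDimensional ℝ E] (h : IsFlatMetric G Ω) {y : E} {δ C c : ℝ}
    (hΩ : Metric.ball y δ ⊆ Ω) (hC : ∀ z ∈ Metric.ball (y, (0 : E)) δ,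
      ∀ z' ∈ Metric.ball (y, (0 : E)) δ,
        |G z'.1 z'.2 z'.2 - G z.1 z.2 z.2 - (fderiv ℝ G z.1 (z'.1 - z.1) z.2 z.2 +
          2 * G z.1 z.2 (z'.2 - z.2))| ≤ C * ‖z' - z‖ ^ 2)
    {p q q' : E} {γ w γ' w' : ℝ → E}
    (ha : IsArc (geodesicAccel G) p q γ w) (ha' : IsArc (geodesicAccel G) p q' γ' w')
    (hb : ∀ t ∈ Icc (0 : ℝ) 1, (γ t, w t) ∈ Metric.ball (y, (0 : E)) δ)
    (hb' : ∀ t ∈ Icc (0 : ℝ) 1, (γ' t, w' t) ∈ Metric.ball (y, (0 : E)) δ)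
    (hc : ∀ t ∈ Icc (0 : ℝ) 1, ‖(γ' t, w' t) - (γ t, w t)‖ ≤ c) :
    |G q' (w' 1) (w' 1) - G q (w 1) (w 1) - 2 * G q (w 1) (q' - q)| ≤ |C| * c ^ 2 := by
  have hmem : ∀ {x v : E}, (x, v) ∈ Metric.ball (y, (0 : E)) δ → x ∈ Ω := fun {x v} hx ↦
    hΩ (lt_of_le_of_lt (le_max_left (dist x y) (dist v 0)) hx)
  have hΩγ : ∀ t ∈ Icc (0 : ℝ) 1, γ t ∈ Ω := fun t ht ↦ hmem (hb t ht)
  have hΩγ' : ∀ t ∈ Icc (0 : ℝ) 1, γ' t ∈ Ω := fun t ht ↦ hmem (hb' t ht)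
  set Δ := G q' (w' 1) (w' 1) - G q (w 1) (w 1) with hΔ
  -- Both energies are constant, so `Δ` is their difference at every time. By the geodesic equation
  -- the linear Taylor term is the derivative of `2 * G (γ t) (w t) (γ' t - γ t)`, which is zero at
  -- `0` because both arcs start at `p`.
  have h1 : ∀ t ∈ Icc (0 : ℝ) 1,
      HasDerivWithinAt (fun t ↦ t * Δ - 2 * G (γ t) (w t) (γ' t - γ t))
        (Δ - (fderiv ℝ G (γ t) (γ' t - γ t) (w t) (w t) + 2 * G (γ t) (w t) (w' t - w t)))
        (Icc 0 1) t := by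
    intro t ht
    have h2 := h.hasDerivWithinAt_apply (γ' := w) (u' := fun t ↦ geodesicAccel G (γ t, w t))
      (v := fun t ↦ γ' t - γ t) (v' := fun t ↦ w' t - w t) (hΩγ t ht) (ha.pos t ht) (ha.vel t ht)
      ((ha'.pos t ht).sub (ha.pos t ht))
    have h3 := ((hasDerivWithinAt_id t (Icc (0 : ℝ) 1)).mul_const Δ).sub (h2.const_mul 2)
    rw [h.apply_geodesicAccel (hΩγ t ht)] at h3
    refine HasDerivWithinAt.congr_deriv h3 ?_
    ring
  have h2 : ∀ t ∈ Icc (0 : ℝ) 1,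
      ‖Δ - (fderiv ℝ G (γ t) (γ' t - γ t) (w t) (w t) + 2 * G (γ t) (w t) (w' t - w t))‖ ≤
        |C| * c ^ 2 := by
    intro t ht
    have h3 := hC _ (hb t ht) _ (hb' t ht)
    simp only at h3
    rw [h.energy_eq ha hΩγ ht, h.energy_eq ha' hΩγ' ht] at h3
    refine h3.trans ?_
    have h4 := pow_le_pow_left₀ (norm_nonneg _) (hc t ht) 2
    exact mul_le_mul (le_abs_self C) h4 (by positivity) (abs_nonneg C)
  have h3 := (convex_Icc (0 : ℝ) 1).norm_image_sub_le_of_norm_hasDerivWithin_le h1 h2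
    (left_mem_Icc.2 zero_le_one) (right_mem_Icc.2 zero_le_one)
  simpa [ha.left, ha'.left, ha.right, ha'.right] using h3

end IsFlatMetric

end Geodesic

/-! ### The local causal relation in a chart. -/

section FlatCausal

set_option maxSynthPendingDepth 3

variable {E : Type*} [NormedAddCommGroup E] [NormedSpace ℝ E]

/-- A smooth Lorentzian metric `G` on the open set `Ω`, time-oriented by the covector field `θ`. -/
structure IsFlatLorentz (G : E → E →L[ℝ] E →L[ℝ] ℝ) (θ : E → E →L[ℝ] ℝ) (Ω : Set E) : Prop
    extends IsFlatMetric G Ω where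
  continuousOn : ContinuousOn θ Ω
  eq_zero : ∀ x ∈ Ω, ∀ v, G x v v ≤ 0 → θ x v = 0 → v = 0
  cone : ∀ x ∈ Ω, ∀ v w, G x v v ≤ 0 → G x w w ≤ 0 → 0 ≤ θ x v → 0 ≤ θ x w → G x v w ≤ 0
  exists_timelike : ∀ x ∈ Ω, ∃ v, G x v v < 0 ∧ 0 < θ x v

/-- `v` is non-spacelike, and future-pointing if nonzero. -/
def FlatCausal (G : E → E →L[ℝ] E →L[ℝ] ℝ) (θ : E → E →L[ℝ] ℝ) (x v : E) : Prop :=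
  G x v v ≤ 0 ∧ (v ≠ 0 → 0 < θ x v)

theorem FlatCausal.nonneg {G : E → E →L[ℝ] E →L[ℝ] ℝ} {θ : E → E →L[ℝ] ℝ} {x v : E}
    (h : FlatCausal G θ x v) : 0 ≤ θ x v := by
  by_cases hv : v = 0
  · simp [hv]
  · exact (h.2 hv).le

namespace IsFlatLorentz

variable {G : E → E →L[ℝ] E →L[ℝ] ℝ} {θ : E → E →L[ℝ] ℝ} {Ω : Set E}

theorem continuousOn_apply_apply (h : IsFlatLorentz G θ Ω) {X : Type*} [TopologicalSpace X]
    {s : Set X} {x v : X → E} (hx : ContinuousOn x s) (hv : ContinuousOn v s)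
    (hΩ : ∀ u ∈ s, x u ∈ Ω) : ContinuousOn (fun u ↦ G (x u) (v u) (v u)) s :=
  ((h.contDiffOn.continuousOn.comp hx hΩ).clm_apply hv).clm_apply hv

theorem continuousOn_apply (h : IsFlatLorentz G θ Ω) {X : Type*} [TopologicalSpace X]
    {s : Set X} {x v : X → E} (hx : ContinuousOn x s) (hv : ContinuousOn v s)
    (hΩ : ∀ u ∈ s, x u ∈ Ω) : ContinuousOn (fun u ↦ θ (x u) (v u)) s :=
  (h.continuousOn.comp hx hΩ).clm_apply hv

/-- Near `y` all vectors in a cone around a timelike vector `e` are timelike. -/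
theorem exists_timelike_cone (h : IsFlatLorentz G θ Ω) {y : E} (hy : y ∈ Ω) :
    ∃ e : E, ∃ δ > 0, ∃ κ > 0, κ < 1 ∧ ∀ x ∈ Metric.ball y δ, ∀ ε > (0 : ℝ), ∀ v,
      ‖v - ε • e‖ ≤ κ * ‖ε • e‖ → G x v v < 0 ∧ 0 < θ x v := by
  obtain ⟨e, he, he'⟩ := h.exists_timelike y hy
  have hop : IsOpen (Ω ×ˢ (univ : Set E)) := h.isOpen.prod isOpen_univ
  have hmem : (y, e) ∈ Ω ×ˢ (univ : Set E) := ⟨hy, mem_univ _⟩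
  have h1 := (h.continuousOn_apply_apply (s := Ω ×ˢ (univ : Set E)) continuousOn_fst
    continuousOn_snd fun z hz ↦ hz.1).continuousAt (hop.mem_nhds hmem)
  have h2 := (h.continuousOn_apply (s := Ω ×ˢ (univ : Set E)) continuousOn_fst
    continuousOn_snd fun z hz ↦ hz.1).continuousAt (hop.mem_nhds hmem)
  obtain ⟨δ, hδ, hball⟩ := Metric.eventually_nhds_iff.1
    ((h1.eventually (gt_mem_nhds he)).and (h2.eventually (lt_mem_nhds he')))
  have hpos : 0 < ‖e‖ + 1 := by positivity
  -- This `κ` satisfies `κ * ‖e‖ < δ`. After division by `ε` the vector lies in the `δ`-ball around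
  -- `e`, and both sign conditions are invariant under positive scaling.
  refine ⟨e, δ, hδ, min (1 / 2) (δ / (‖e‖ + 1)), lt_min (by norm_num) (by positivity),
    lt_of_le_of_lt (min_le_left _ _) (by norm_num), fun x hx ε hε v hv ↦ ?_⟩
  have h3 : ‖ε⁻¹ • v - e‖ < δ := by
    have h4 : ε⁻¹ • v - e = ε⁻¹ • (v - ε • e) := by
      rw [smul_sub, smul_smul, inv_mul_cancel₀ hε.ne', one_smul]
    have h5 : min (1 / 2) (δ / (‖e‖ + 1)) * ‖e‖ < δ := by
      calc _ ≤ δ / (‖e‖ + 1) * ‖e‖ := by gcongr; exact min_le_right _ _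
        _ < δ := by rw [div_mul_eq_mul_div, div_lt_iff₀ hpos]; nlinarith
    rw [norm_smul, Real.norm_of_nonneg hε.le] at hv
    rw [h4, norm_smul, norm_inv, Real.norm_of_nonneg hε.le, inv_mul_lt_iff₀ hε]
    nlinarith
  have h6 := @hball (x, ε⁻¹ • v) (by
    rw [Prod.dist_eq, dist_eq_norm (ε⁻¹ • v) e]
    exact max_lt hx h3)
  simp only [map_smul, smul_apply, smul_eq_mul] at h6
  have hi : 0 < ε⁻¹ := inv_pos.2 hε
  exact ⟨by_contra fun hn ↦ absurd h6.1 (not_lt.2 (by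
    have := not_lt.1 hn
    positivity)), (pos_iff_pos_of_mul_pos h6.2).1 hi⟩

/-- A causal curve keeps the energy of the connecting geodesics negative. Here `P u` is the final
velocity of the geodesic connecting a fixed point to `c u`. -/
theorem energy_le_of_causal (h : IsFlatLorentz G θ Ω) {a b : ℝ} (hab : a ≤ b) {c c' P : ℝ → E}
    (hc : ∀ u ∈ Icc a b, HasDerivWithinAt c (c' u) (Icc a b) u) (hΩ : ∀ u ∈ Icc a b, c u ∈ Ω)
    (hcc : ∀ u ∈ Icc a b, FlatCausal G θ (c u) (c' u)) (hP : ContinuousOn P (Icc a b))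
    (hder : ∀ u ∈ Icc a b, HasDerivWithinAt (fun u ↦ G (c u) (P u) (P u))
      (2 * G (c u) (P u) (c' u)) (Icc a b) u)
    (ha : G (c a) (P a) (P a) < 0) (ha' : 0 ≤ θ (c a) (P a)) :
    G (c b) (P b) (P b) ≤ 0 ∧ 0 ≤ θ (c b) (P b) := by
  have hcont : ContinuousOn c (Icc a b) := fun u hu ↦ (hc u hu).continuousWithinAt
  set f := fun u ↦ G (c u) (P u) (P u)
  set k := fun u ↦ θ (c u) (P u)
  have hf : ContinuousOn f (Icc a b) := h.continuousOn_apply_apply hcont hP hΩ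
  have hk : ContinuousOn k (Icc a b) := h.continuousOn_apply hcont hP hΩ
  -- Continuous induction. Negative energy excludes `k = 0`, so `f < 0 < k` persists for a short
  -- time. During that time the cone condition gives `G (c u) (P u) (c' u) ≤ 0`, and `f` cannot
  -- increase.
  have hsub : Icc a b ⊆ {u | f u ≤ f a ∧ 0 ≤ k u} := by
    apply IsClosed.Icc_subset_of_forall_mem_nhdsWithin
    · have h1 := (hf.preimage_isClosed_of_isClosed isClosed_Icc (isClosed_Iic (a := f a))).inter
        (hk.preimage_isClosed_of_isClosed isClosed_Icc (isClosed_Ici (a := 0)))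
      convert h1 using 1
      ext u
      simp only [mem_inter_iff, mem_ofPred_eq, mem_preimage, mem_Iic, mem_Ici]
      tauto
    · exact ⟨le_rfl, ha'⟩
    · rintro x ⟨⟨hx1, hx2⟩, hxa, hxb⟩
      have hx : x ∈ Icc a b := ⟨hxa, hxb.le⟩
      have hfx : f x < 0 := lt_of_le_of_lt hx1 ha
      have hkx : 0 < k x := by
        refine lt_of_le_of_ne hx2 fun h0 ↦ ?_
        have : P x = 0 := h.eq_zero _ (hΩ x hx) _ hfx.le h0.symm
        simp [f, this] at hfx
      have hev := ((hf x hx).eventually (gt_mem_nhds hfx)).and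
        ((hk x hx).eventually (lt_mem_nhds hkx))
      rw [eventually_nhdsWithin_iff, Metric.eventually_nhds_iff] at hev
      obtain ⟨η, hη, hev⟩ := hev
      obtain ⟨z, hz1, hz2⟩ : ∃ z, x < z ∧ z < min (x + η) b :=
        exists_between (lt_min (by linarith) hxb)
      have hzη : z < x + η := hz2.trans_le (min_le_left _ _)
      have hzb : z < b := hz2.trans_le (min_le_right _ _)
      have hsub : Icc x z ⊆ Icc a b := Icc_subset_Icc hxa hzb.le
      have hneg : ∀ s ∈ Icc x z, f s < 0 ∧ 0 < k s := fun s hs ↦ by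
        refine hev ?_ (hsub hs)
        rw [Real.dist_eq, abs_of_nonneg (by linarith [hs.1])]
        linarith [hs.2]
      have hanti : AntitoneOn f (Icc x z) := by
        refine antitoneOn_of_hasDerivWithinAt_nonpos (convex_Icc x z) (hf.mono hsub)
          (f' := fun u ↦ 2 * G (c u) (P u) (c' u))
          (fun u hu ↦ (hder u (hsub (interior_subset hu))).mono
            (interior_subset.trans hsub)) fun u hu ↦ ?_
        have hu' := interior_subset hu
        have := h.cone _ (hΩ u (hsub hu')) (P u) (c' u) (hneg u hu').1.le (hcc u (hsub hu')).1
          (hneg u hu').2.le (hcc u (hsub hu')).nonneg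
        linarith
      refine mem_of_superset (Ioc_mem_nhdsGT hz1) fun s hs ↦ ?_
      have hs' : s ∈ Icc x z := ⟨hs.1.le, hs.2⟩
      exact ⟨(hanti (left_mem_Icc.2 hz1.le) hs' hs.1.le).trans hx1, (hneg s hs').2.le⟩
  have hb := hsub (right_mem_Icc.2 hab)
  exact ⟨hb.1.trans ha.le, hb.2⟩

/-- Every point has a ball in which the causal relation is closed: it is given by geodesics. -/
theorem exists_local_causal_relation [FiniteDimensional ℝ E] (h : IsFlatLorentz G θ Ω) {y : E}
    (hy : y ∈ Ω) :
    ∃ r > 0, Metric.closedBall y r ⊆ Ω ∧ ∃ N : Set (E × E), IsClosed N ∧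
      N ⊆ Metric.closedBall y r ×ˢ Metric.closedBall y r ∧
      (∀ p q, (p, q) ∈ N → ∃ γ w : ℝ → E, γ 0 = p ∧ γ 1 = q ∧ ContDiffOn ℝ ∞ γ (Icc 0 1) ∧
        ∀ t ∈ Icc (0 : ℝ) 1, γ t ∈ Ω ∧ HasDerivWithinAt γ (w t) (Icc 0 1) t ∧
          FlatCausal G θ (γ t) (w t)) ∧
      ∀ (a b : ℝ) (c c' : ℝ → E), a ≤ b →
        (∀ u ∈ Icc a b, HasDerivWithinAt c (c' u) (Icc a b) u ∧ c u ∈ Metric.closedBall y r ∧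
          FlatCausal G θ (c u) (c' u)) → (c a, c b) ∈ N := by
  obtain ⟨e, δ₁, hδ₁, κ, hκ, hκ1, hcone⟩ := h.exists_timelike_cone hy
  obtain ⟨δ₂, hδ₂, C, hΩ₂, hC⟩ := h.exists_energy_taylor hy
  obtain ⟨δ, hδ, hδδ₁, hδδ₂⟩ : ∃ δ > 0, δ ≤ δ₁ ∧ δ ≤ δ₂ :=
    ⟨min δ₁ δ₂, lt_min hδ₁ hδ₂, min_le_left _ _, min_le_right _ _⟩
  have hΩδ : Metric.ball y δ ⊆ Ω := (Metric.ball_subset_ball hδδ₂).trans hΩ₂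
  obtain ⟨r, hr, γ, w, hfam⟩ := exists_isArc_family (h.hasStrictFDerivAt_geodesicAccel hy)
    (Eventually.of_forall fun x ↦ geodesicAccel_zero G x) hκ hδ
  have harc := fun p hp q hq ↦ (hfam p hp q hq).1
  have hmem : ∀ p ∈ Metric.ball y r, ∀ q ∈ Metric.ball y r, ∀ t ∈ Icc (0 : ℝ) 1,
      γ p q t ∈ Metric.ball y δ := fun p hp q hq t ht ↦
    lt_of_le_of_lt (le_max_left (dist (γ p q t) y) (dist (w p q t) 0))
      ((hfam p hp q hq).2.1 t ht).1
  have h01 : (1 : ℝ) ∈ Icc (0 : ℝ) 1 := right_mem_Icc.2 zero_le_one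
  have hrδ : Metric.ball y r ⊆ Metric.ball y δ := fun q hq ↦ by
    have := hmem q hq q hq 1 h01
    rwa [(harc q hq q hq).right] at this
  have hrΩ : Metric.ball y r ⊆ Ω := hrδ.trans hΩδ
  set P : E × E → E := fun z ↦ w z.1 z.2 1
  have hPc : ContinuousOn P (Metric.ball y r ×ˢ Metric.ball y r) := by
    have : LipschitzOnWith 4 P (Metric.ball y r ×ˢ Metric.ball y r) := by
      refine LipschitzOnWith.of_dist_le_mul fun z hz z' hz' ↦ ?_
      have h1 := (((hfam z.1 hz.1 z.2 hz.2).2.2) z'.1 hz'.1 z'.2 hz'.2 1 h01).2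
      rw [dist_eq_norm, dist_eq_norm, Prod.norm_def]
      have h2 := le_max_left ‖(z - z').1‖ ‖(z - z').2‖
      have h3 := le_max_right ‖(z - z').1‖ ‖(z - z').2‖
      refine h1.trans ?_
      simp only [Prod.fst_sub, Prod.snd_sub, NNReal.coe_ofNat] at h2 h3 ⊢
      linarith
    exact this.continuousOn
  -- The relation is placed on the half ball so that slightly shifted starting points still lie in
  -- the ball where arcs are available.
  have hcB : Metric.closedBall y (r / 2) ⊆ Metric.ball y r :=
    Metric.closedBall_subset_ball (by linarith)
  set B := Metric.closedBall y (r / 2)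
  have hderiv : ∀ p ∈ Metric.ball y r, ∀ q ∈ Metric.ball y r,
      HasFDerivAt (fun q ↦ G q (P (p, q)) (P (p, q))) ((2 : ℝ) • G q (P (p, q))) q := by
    intro p hp q hq
    -- The quadratic error in the first variation gives differentiability of the energy, although
    -- `P` is only known to be Lipschitz.
    have hO : (fun q' ↦ G q' (P (p, q')) (P (p, q')) - G q (P (p, q)) (P (p, q)) -
        2 * G q (P (p, q)) (q' - q)) =O[𝓝 q] fun q' ↦ ‖q' - q‖ ^ 2 := by
      refine Asymptotics.IsBigO.of_bound (|C| * 9) ?_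
      filter_upwards [Metric.isOpen_ball.mem_nhds hq] with q' hq'
      have h1 := h.abs_energy_sub_le hΩ₂ hC (harc p hp q hq) (harc p hp q' hq')
        (fun t ht ↦ Metric.ball_subset_ball hδδ₂ ((hfam p hp q hq).2.1 t ht).1)
        (fun t ht ↦ Metric.ball_subset_ball hδδ₂ ((hfam p hp q' hq').2.1 t ht).1)
        (c := 3 * ‖q' - q‖) (fun t ht ↦ by
          have h2 := ((hfam p hp q' hq').2.2) p hp q hq t ht
          simp only [sub_self, norm_zero, zero_add] at h2
          rw [Prod.norm_def]
          exact max_le h2.1 (h2.2.trans (by linarith [norm_nonneg (q' - q)])))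
      rw [Real.norm_eq_abs, Real.norm_of_nonneg (by positivity)]
      calc _ ≤ _ := h1
        _ = _ := by ring
    have h0 := Asymptotics.IsBigO.hasFDerivAt (𝕜 := ℝ) hO (by norm_num)
    have h1 : HasFDerivAt (fun q' ↦ G q (P (p, q)) (P (p, q)) + 2 * G q (P (p, q)) (q' - q))
        ((2 : ℝ) • G q (P (p, q))) q := by
      have h3 := HasFDerivAt.comp q (f := fun q' ↦ q' - q)
        (G q (P (p, q))).hasFDerivAt ((hasFDerivAt_id q).sub_const q)
      exact (h3.const_mul 2).const_add _
    have h2 := h0.add h1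
    rw [zero_add] at h2
    refine h2.congr_of_eventuallyEq (Eventually.of_forall fun q' ↦ ?_)
    simp only [Pi.add_apply]
    ring
  have hBB : B ×ˢ B ⊆ Metric.ball y r ×ˢ Metric.ball y r := prod_mono hcB hcB
  have hGc : ContinuousOn (fun z : E × E ↦ G z.2 (P z) (P z))
      (Metric.ball y r ×ˢ Metric.ball y r) :=
    h.continuousOn_apply_apply continuousOn_snd hPc fun z hz ↦ hrΩ hz.2
  have hθc : ContinuousOn (fun z : E × E ↦ θ z.2 (P z)) (Metric.ball y r ×ˢ Metric.ball y r) :=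
    h.continuousOn_apply continuousOn_snd hPc fun z hz ↦ hrΩ hz.2
  have hBcl : IsClosed (B ×ˢ B) := Metric.isClosed_closedBall.prod Metric.isClosed_closedBall
  refine ⟨r / 2, by positivity, hcB.trans hrΩ,
    (B ×ˢ B ∩ (fun z ↦ G z.2 (P z) (P z)) ⁻¹' Iic 0) ∩ (B ×ˢ B ∩ (fun z ↦ θ z.2 (P z)) ⁻¹' Ici 0),
    ((hGc.mono hBB).preimage_isClosed_of_isClosed hBcl isClosed_Iic).inter
      ((hθc.mono hBB).preimage_isClosed_of_isClosed hBcl isClosed_Ici),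
    fun z hz ↦ hz.1.1, ?_, ?_⟩
  · rintro p q ⟨⟨⟨hpB, hqB⟩, hG : G q (w p q 1) (w p q 1) ≤ 0⟩, -, hθ : 0 ≤ θ q (w p q 1)⟩
    have hp := hcB hpB
    have hq := hcB hqB
    have ha := harc p hp q hq
    have hγΩ : ∀ t ∈ Icc (0 : ℝ) 1, γ p q t ∈ Ω := fun t ht ↦ hΩδ (hmem p hp q hq t ht)
    have hE : ∀ t ∈ Icc (0 : ℝ) 1, G (γ p q t) (w p q t) (w p q t) ≤ 0 := fun t ht ↦ by
      rw [h.energy_eq ha hγΩ ht]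
      exact hG
    refine ⟨γ p q, w p q, ha.left, ha.right, ha.contDiffOn h.contDiffOn_geodesicAccel
      fun t ht ↦ ⟨hγΩ t ht, mem_univ _⟩, fun t ht ↦ ⟨hγΩ t ht, ha.pos t ht, hE t ht, fun hwt ↦ ?_⟩⟩
    have hpq : q - p ≠ 0 := by
      intro hpq
      have := ((hfam p hp q hq).2.1 t ht).2
      rw [hpq, norm_zero, mul_zero, sub_zero, norm_le_zero_iff] at this
      exact hwt this
    -- A zero would force zero velocity, which is incompatible with `‖w - (q - p)‖ ≤ κ * ‖q - p‖`
    -- and `κ < 1`. Hence the sign at the endpoint holds along the whole geodesic.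
    have hne : ∀ s ∈ Icc (0 : ℝ) 1, θ (γ p q s) (w p q s) ≠ 0 := by
      intro s hs h0
      have h1 := h.eq_zero _ (hγΩ s hs) _ (hE s hs) h0
      have h2 := ((hfam p hp q hq).2.1 s hs).2
      rw [h1, zero_sub, norm_neg] at h2
      have := norm_pos_iff.2 hpq
      nlinarith
    have hc : ContinuousOn (fun s ↦ θ (γ p q s) (w p q s)) (Icc 0 1) :=
      h.continuousOn_apply (fun s hs ↦ (ha.pos s hs).continuousWithinAt)
        (fun s hs ↦ (ha.vel s hs).continuousWithinAt) hγΩ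
    by_contra hneg
    have hsub : Icc t 1 ⊆ Icc (0 : ℝ) 1 := Icc_subset_Icc_left ht.1
    obtain ⟨s, hs, hs0⟩ := intermediate_value_Icc ht.2 (hc.mono hsub)
      (show (0 : ℝ) ∈ Icc (θ (γ p q t) (w p q t)) (θ (γ p q 1) (w p q 1)) from
        ⟨not_lt.1 hneg, by rwa [ha.right]⟩)
    exact hne s (hsub hs) hs0
  · intro a b c c' hab hc
    have hca := (hc a (left_mem_Icc.2 hab)).2.1
    have hcb := (hc b (right_mem_Icc.2 hab)).2.1
    have hccont : ContinuousOn c (Icc a b) := fun u hu ↦ (hc u hu).1.continuousWithinAt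
    have hlim : Tendsto (fun ε : ℝ ↦ (c a - ε • e, c b)) (𝓝[>] 0) (𝓝 (c a, c b)) := by
      have h1 : Continuous fun ε : ℝ ↦ (c a - ε • e, c b) := by fun_prop
      have h2 := h1.tendsto 0
      rw [zero_smul, sub_zero] at h2
      exact h2.mono_left nhdsWithin_le_nhds
    have hnhds : Metric.ball y r ×ˢ Metric.ball y r ∈ 𝓝 (c a, c b) :=
      (Metric.isOpen_ball.prod Metric.isOpen_ball).mem_nhds ⟨hcB hca, hcB hcb⟩
    -- At `u = a` the energy from `c a` is zero, so the induction cannot start there. Moving the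
    -- base point back to `c a - ε • e` gives a final velocity close to `ε • e`, hence strictly
    -- timelike; then `ε` tends to `0`.
    have key : ∀ᶠ ε : ℝ in 𝓝[>] 0, G (c b) (P (c a - ε • e, c b)) (P (c a - ε • e, c b)) ≤ 0 ∧
        0 ≤ θ (c b) (P (c a - ε • e, c b)) := by
      filter_upwards [self_mem_nhdsWithin, hlim.eventually hnhds] with ε hε hεr
      have hp : c a - ε • e ∈ Metric.ball y r := hεr.1
      have hstart := hcone (c a) (Metric.ball_subset_ball hδδ₁ (hrδ (hcB hca))) ε hε
        (P (c a - ε • e, c a)) (by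
          have := ((hfam _ hp _ (hcB hca)).2.1 1 h01).2
          rwa [sub_sub_cancel] at this)
      exact h.energy_le_of_causal hab (P := fun u ↦ P (c a - ε • e, c u)) (fun u hu ↦ (hc u hu).1)
        (fun u hu ↦ hrΩ (hcB (hc u hu).2.1)) (fun u hu ↦ (hc u hu).2.2)
        (hPc.comp (continuousOn_const.prodMk hccont) fun u hu ↦ ⟨hp, hcB (hc u hu).2.1⟩)
        (fun u hu ↦ (hderiv _ hp _ (hcB (hc u hu).2.1)).comp_hasDerivWithinAt u (hc u hu).1)
        hstart.1 hstart.2.le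
    exact ⟨⟨⟨hca, hcb⟩, le_of_tendsto ((hGc.continuousAt hnhds).tendsto.comp hlim)
      (key.mono fun ε hε ↦ hε.1)⟩, ⟨hca, hcb⟩,
        ge_of_tendsto ((hθc.continuousAt hnhds).tendsto.comp hlim) (key.mono fun ε hε ↦ hε.2)⟩

end IsFlatLorentz

end FlatCausal

/-! ### Linear algebra of Lorentzian scalar products and time functions. -/

namespace LorentzMetric

variable {m : ℕ} {M : Type*} [TopologicalSpace M]
  [ChartedSpace (EuclideanSpace ℝ (Fin (m + 1))) M] [IsManifold (𝓡 (m + 1)) ∞ M]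
  (g : LorentzMetric m M)

/-- A non-spacelike vector orthogonal to a timelike vector is zero. -/
theorem eq_zero_of_orthogonal {x : M} {N v : TangentSpace (𝓡 (m + 1)) x} (hN : g.IsTimelike N)
    (hv : g.inner x v v ≤ 0) (h : g.inner x N v = 0) : v = 0 := by
  obtain ⟨b, hb⟩ := g.signature x
  have key : ∀ u w : TangentSpace (𝓡 (m + 1)) x, g.inner x u w =
      -(b.repr u 0 * b.repr w 0) + ∑ i : Fin m, b.repr u i.succ * b.repr w i.succ := by
    intro u w
    conv_lhs => rw [← b.sum_repr u, ← b.sum_repr w]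
    simp only [map_sum, map_smul, sum_apply, smul_apply, hb, smul_eq_mul, mul_ite, mul_zero,
      Finset.sum_ite_eq', Finset.mem_univ, if_true]
    rw [Fin.sum_univ_succ]
    simp [Fin.succ_ne_zero, mul_comm]
  rw [IsTimelike, key] at hN
  rw [key] at hv h
  have hcs := Finset.sum_mul_sq_le_sq_mul_sq Finset.univ (fun i : Fin m ↦ b.repr N i.succ)
    (fun i : Fin m ↦ b.repr v i.succ)
  simp only [pow_two] at hcs
  set SN := ∑ i : Fin m, b.repr N i.succ * b.repr N i.succ
  set Sv := ∑ i : Fin m, b.repr v i.succ * b.repr v i.succ with hSv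
  set SNv := ∑ i : Fin m, b.repr N i.succ * b.repr v i.succ
  have hSN0 : 0 ≤ SN := Finset.sum_nonneg fun i _ ↦ mul_self_nonneg _
  have hSv0 : 0 ≤ Sv := Finset.sum_nonneg fun i _ ↦ mul_self_nonneg _
  have hSNv : SNv = b.repr N 0 * b.repr v 0 := by linarith
  -- Orthogonality, Cauchy–Schwarz and `Sv ≤ v₀²` give `(N₀ v₀)² ≤ SN * v₀²`, while `SN < N₀²`.
  have h1 : (b.repr N 0 * b.repr N 0 - SN) * (b.repr v 0 * b.repr v 0) ≤ 0 := by
    rw [hSNv] at hcs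
    nlinarith
  have h2 : b.repr v 0 * b.repr v 0 ≤ 0 := by
    by_contra hn
    nlinarith
  have h3 : b.repr v 0 = 0 := mul_self_eq_zero.1 (le_antisymm h2 (mul_self_nonneg _))
  have h4 : Sv = 0 := le_antisymm (by linarith) hSv0
  rw [hSv, Finset.sum_eq_zero_iff_of_nonneg fun i _ ↦ mul_self_nonneg _] at h4
  apply b.repr.map_eq_zero_iff.1
  ext i
  refine Fin.cases h3 (fun j ↦ ?_) i
  exact mul_self_eq_zero.1 (h4 j (Finset.mem_univ j))

/-- Two non-spacelike vectors on the same side of the orthogonal complement of a timelike vector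
have nonpositive scalar product. -/
theorem inner_nonpos_of_causal {x : M} {N v w : TangentSpace (𝓡 (m + 1)) x}
    (hN : g.IsTimelike N) (hv : g.inner x v v ≤ 0) (hw : g.inner x w w ≤ 0)
    (hNv : 0 ≤ g.inner x N v) (hNw : 0 ≤ g.inner x N w) : g.inner x v w ≤ 0 := by
  have hn : g.inner x N N < 0 := hN
  have hpos : ∀ u, g.inner x N u = 0 → 0 ≤ g.inner x u u := fun u hu ↦ by
    by_contra h
    have := g.eq_zero_of_orthogonal hN (not_le.1 h).le hu
    simp [this] at h
  obtain ⟨n, hn'⟩ : ∃ n, n = -g.inner x N N := ⟨_, rfl⟩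
  have hnpos : 0 < n := by linarith
  obtain ⟨A, hA⟩ : ∃ A, A = g.inner x N v / n := ⟨_, rfl⟩
  obtain ⟨B, hB⟩ : ∃ B, B = g.inner x N w / n := ⟨_, rfl⟩
  have hA0 : 0 ≤ A := hA ▸ div_nonneg hNv hnpos.le
  have hB0 : 0 ≤ B := hB ▸ div_nonneg hNw hnpos.le
  have hAn : g.inner x N v = A * n := by rw [hA]; field_simp
  have hBn : g.inner x N w = B * n := by rw [hB]; field_simp
  have hNN : g.inner x N N = -n := by linarith
  -- `v + A • N` and `w + B • N` are the components orthogonal to `N`, where the form is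
  -- nonnegative. The discriminant gives Cauchy–Schwarz for them. Their squares are at most `A ^ 2 *
  -- n` and `B ^ 2 * n`, so their product cannot exceed `A * B * n`.
  have h1 : ∀ s : ℝ, 0 ≤ (g.inner x w w + B ^ 2 * n) * (s * s) +
      (2 * (g.inner x v w + A * B * n)) * s + (g.inner x v v + A ^ 2 * n) := by
    intro s
    have h2 := hpos ((v + A • N) + s • (w + B • N)) (by
      simp only [map_add, map_smul, smul_eq_mul, hAn, hBn, hNN]
      ring)
    simp only [map_add, map_smul, add_apply, smul_apply, smul_eq_mul, hAn, hBn, hNN,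
      g.symm x v N, g.symm x w N, g.symm x w v] at h2
    linarith
  have h2 := discrim_le_zero h1
  rw [discrim] at h2
  by_contra hc
  have hc' := not_le.1 hc
  have hAB : 0 ≤ A * B * n := by positivity
  have h3 : (A * B * n) ^ 2 < (g.inner x v w + A * B * n) ^ 2 :=
    pow_lt_pow_left₀ (by linarith) hAB (by norm_num)
  have hvp : 0 ≤ g.inner x v v + A ^ 2 * n := by simpa using h1 0
  have hwp : 0 ≤ g.inner x w w + B ^ 2 * n := by
    have h2 := hpos (w + B • N) (by
      simp only [map_add, map_smul, smul_eq_mul, hBn, hNN]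
      ring)
    simp only [map_add, map_smul, add_apply, smul_apply, smul_eq_mul, hBn, hNN,
      g.symm x w N] at h2
    linarith
  have h4 : (g.inner x v v + A ^ 2 * n) * (g.inner x w w + B ^ 2 * n) ≤
      (A ^ 2 * n) * (B ^ 2 * n) :=
    mul_le_mul (by linarith) (by linarith) hwp (by positivity)
  nlinarith

theorem isFutureCausal_neg_grad_iff {t : M → ℝ} {x : M} {v : TangentSpace (𝓡 (m + 1)) x} :
    g.IsFutureCausal (fun x ↦ -g.grad t x) v ↔
      g.inner x v v ≤ 0 ∧ (v ≠ 0 → 0 < g.inner x (g.grad t x) v) := by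
  have : g.inner x v (-g.grad t x) = -g.inner x (g.grad t x) v := by rw [map_neg, g.symm]
  rw [IsFutureCausal, this]
  simp only [Left.neg_neg_iff]

theorem grad_neg (t : M → ℝ) (x : M) : g.grad (fun x ↦ -t x) x = -g.grad t x := by
  rw [← sub_eq_zero]
  refine g.eq_zero_of_inner_eq_zero x _ fun w ↦ ?_
  have h1 : mfderiv (𝓡 (m + 1)) 𝓘(ℝ, ℝ) (fun x ↦ -t x) x w =
      -mfderiv (𝓡 (m + 1)) 𝓘(ℝ, ℝ) t x w := by
    rw [show (fun x ↦ -t x) = -t from rfl, mfderiv_neg]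
    rfl
  have h2 := g.inner_grad (fun x ↦ -t x) x w
  have h3 := g.inner_grad t x w
  rw [map_sub, map_neg, sub_apply, neg_apply, h2, h3, h1]
  exact sub_self _

theorem IsTimeFunction.neg {g : LorentzMetric m M} {t : M → ℝ} (h : g.IsTimeFunction t) :
    g.IsTimeFunction (fun x ↦ -t x) := by
  refine ⟨h.1.neg, fun x ↦ ?_⟩
  rw [g.grad_neg, IsTimelike]
  simpa [IsTimelike] using h.2 x

theorem IsFutureCausal.smul {g : LorentzMetric m M} {T : (x : M) → TangentSpace (𝓡 (m + 1)) x}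
    {x : M} {v : TangentSpace (𝓡 (m + 1)) x} (h : g.IsFutureCausal T v) {r : ℝ} (hr : 0 ≤ r) :
    g.IsFutureCausal T (r • v) := by
  constructor
  · have := h.1
    simp only [map_smul, smul_apply, smul_eq_mul]
    exact mul_nonpos_of_nonneg_of_nonpos hr (mul_nonpos_of_nonneg_of_nonpos hr this)
  · intro hrv
    have hr' : 0 < r := lt_of_le_of_ne hr fun h0 ↦ hrv (by rw [← h0, zero_smul])
    have := h.2 fun h0 ↦ hrv (by rw [h0, smul_zero])
    simp only [map_smul, smul_apply, smul_eq_mul]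
    exact mul_neg_of_pos_of_neg hr' this

end LorentzMetric

/-! ### Causal lines and smooth concatenation. -/

namespace LorentzMetric

variable {m : ℕ} {M : Type*} [TopologicalSpace M]
  [ChartedSpace (EuclideanSpace ℝ (Fin (m + 1))) M] [IsManifold (𝓡 (m + 1)) ∞ M]
  {g : LorentzMetric m M} {T : (x : M) → TangentSpace (𝓡 (m + 1)) x}

/-- A future-directed causal curve defined on the whole real line. -/
def IsCausalLine (g : LorentzMetric m M) (T : (x : M) → TangentSpace (𝓡 (m + 1)) x)
    (c : ℝ → M) : Prop :=
  ContMDiff 𝓘(ℝ, ℝ) (𝓡 (m + 1)) ∞ c ∧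
    ∀ u, g.IsFutureCausal T
      (mfderiv 𝓘(ℝ, ℝ) (𝓡 (m + 1)) c u (1 : TangentSpace 𝓘(ℝ, ℝ) u))

theorem isFutureCausal_zero {x : M} :
    g.IsFutureCausal T (0 : TangentSpace (𝓡 (m + 1)) x) :=
  ⟨by simp, fun h ↦ absurd rfl h⟩

theorem isCausalLine_const (x : M) : g.IsCausalLine T fun _ ↦ x := by
  refine ⟨contMDiff_const, fun u ↦ ?_⟩
  rw [mfderiv_const]
  exact isFutureCausal_zero

theorem IsCausalLine.isFutureCausalCurve {c : ℝ → M} (h : g.IsCausalLine T c) {s : Set ℝ}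
    (hs : UniqueDiffOn ℝ s) : g.IsFutureCausalCurve T c s := by
  refine ⟨h.1.contMDiffOn, fun u hu ↦ ?_⟩
  rw [mfderivWithin_eq_mfderiv (hs u hu).uniqueMDiffWithinAt
    ((h.1 u).mdifferentiableAt (by simp))]
  exact h.2 u

theorem IsCausalLine.mem_causalFuture_of_lt {c : ℝ → M} (h : g.IsCausalLine T c) {a b : ℝ}
    (hab : a < b) : c b ∈ g.causalFuture T (c a) :=
  ⟨c, a, b, hab, h.isFutureCausalCurve (uniqueDiffOn_Icc hab), rfl, rfl⟩

theorem mem_causalFuture_self (x : M) : x ∈ g.causalFuture T x :=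
  (isCausalLine_const x).mem_causalFuture_of_lt zero_lt_one

theorem IsCausalLine.mem_causalFuture {c : ℝ → M} (h : g.IsCausalLine T c) {a b : ℝ}
    (hab : a ≤ b) : c b ∈ g.causalFuture T (c a) := by
  rcases hab.eq_or_lt with rfl | hab
  · exact mem_causalFuture_self _
  · exact h.mem_causalFuture_of_lt hab

/-- All tangent spaces are copies of the model space, so vectors at propositionally equal base
points can be compared there without a cast. -/
theorem isFutureCausal_congr {x y : M} (hxy : x = y) {v : TangentSpace (𝓡 (m + 1)) x}
    {w : TangentSpace (𝓡 (m + 1)) y} (hvw : (v : EuclideanSpace ℝ (Fin (m + 1))) = w) :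
    g.IsFutureCausal T v ↔ g.IsFutureCausal T w := by
  subst hxy
  cases hvw
  rfl

/-- Being a causal line is a local property, invariant under translation of the parameter. -/
theorem isCausalLine_of_eventuallyEq {c : ℝ → M}
    (h : ∀ u, ∃ c' u', g.IsCausalLine T c' ∧ c =ᶠ[𝓝 u] fun s ↦ c' (s - u')) :
    g.IsCausalLine T c := by
  have hsub : ∀ u' : ℝ, ContMDiff 𝓘(ℝ, ℝ) 𝓘(ℝ, ℝ) ∞ fun s : ℝ ↦ s - u' := fun u' ↦
    (contDiff_id.sub contDiff_const).contMDiff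
  refine ⟨fun u ↦ ?_, fun u ↦ ?_⟩ <;> obtain ⟨c', u', hc', he⟩ := h u
  · exact ((hc'.1.comp (hsub u')).contMDiffAt).congr_of_eventuallyEq he
  · have h1 : mfderiv 𝓘(ℝ, ℝ) (𝓡 (m + 1)) c u (1 : TangentSpace 𝓘(ℝ, ℝ) u) =
        mfderiv 𝓘(ℝ, ℝ) (𝓡 (m + 1)) c' (u - u') (1 : TangentSpace 𝓘(ℝ, ℝ) (u - u')) := by
      have h2 := HasMFDerivAt.comp u (f := fun s : ℝ ↦ s - u')
        ((hc'.1 (u - u')).mdifferentiableAt (by simp)).hasMFDerivAt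
        ((hasDerivAt_id u).sub_const u').hasFDerivAt.hasMFDerivAt
      rw [he.mfderiv_eq]
      erw [h2.mfderiv]
      change mfderiv 𝓘(ℝ, ℝ) (𝓡 (m + 1)) c' (u - u') ((1 : ℝ) • (1 : ℝ)) = _
      rw [one_smul]
      rfl
    exact (isFutureCausal_congr he.self_of_nhds h1).2 (hc'.2 (u - u'))

/-- Causally related points are joined by a causal line which is constant near both ends. -/
theorem exists_isCausalLine {x y : M} (h : y ∈ g.causalFuture T x) :
    ∃ c : ℝ → M, g.IsCausalLine T c ∧ (∀ u ≤ 1 / 3, c u = x) ∧ ∀ u ≥ 2 / 3, c u = y := by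
  obtain ⟨c, a, b, hab, ⟨hc, hcc⟩, rfl, rfl⟩ := h
  -- Causal curves may have zero velocity, so a smooth monotone reparametrization can rest at both
  -- ends.
  obtain ⟨φ, hφ⟩ : ∃ φ : ℝ → ℝ, φ = fun u ↦ a + (b - a) * Real.smoothTransition (3 * u - 1) :=
    ⟨_, rfl⟩
  have hφs : ContDiff ℝ ∞ φ := by
    rw [hφ]
    exact contDiff_const.add (contDiff_const.mul (Real.smoothTransition.contDiff.comp
      ((contDiff_const.mul contDiff_id).sub contDiff_const)))
  have hφI : ∀ u, φ u ∈ Icc a b := fun u ↦ by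
    have h0 := Real.smoothTransition.nonneg (3 * u - 1)
    have h1 := Real.smoothTransition.le_one (3 * u - 1)
    rw [hφ]
    constructor <;> dsimp only <;> nlinarith
  have hφm : Monotone φ := by
    rw [hφ]
    intro u v huv
    have h0 := Real.smoothTransition.monotone (show 3 * u - 1 ≤ 3 * v - 1 by linarith)
    dsimp only
    nlinarith
  refine ⟨c ∘ φ, ⟨hc.comp_contMDiff hφs.contMDiff hφI, fun u ↦ ?_⟩, fun u hu ↦ ?_, fun u hu ↦ ?_⟩
  · have h1 := ((hc (φ u) (hφI u)).mdifferentiableWithinAt (by simp)).hasMFDerivWithinAt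
    have h2 : HasMFDerivAt 𝓘(ℝ, ℝ) 𝓘(ℝ, ℝ) φ u _ :=
      ((hφs.differentiable (by simp)) u).hasDerivAt.hasFDerivAt.hasMFDerivAt
    have h3 := HasMFDerivWithinAt.comp u h1 (h2.hasMFDerivWithinAt (s := univ))
      fun v _ ↦ hφI v
    rw [hasMFDerivWithinAt_univ] at h3
    have h4 : mfderiv 𝓘(ℝ, ℝ) (𝓡 (m + 1)) (c ∘ φ) u (1 : TangentSpace 𝓘(ℝ, ℝ) u) =
        deriv φ u • mfderivWithin 𝓘(ℝ, ℝ) (𝓡 (m + 1)) c (Icc a b) (φ u)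
          (1 : TangentSpace 𝓘(ℝ, ℝ) (φ u)) := by
      rw [h3.mfderiv, ← map_smul]
      change mfderivWithin 𝓘(ℝ, ℝ) (𝓡 (m + 1)) c (Icc a b) (φ u) ((1 : ℝ) • deriv φ u) =
        mfderivWithin 𝓘(ℝ, ℝ) (𝓡 (m + 1)) c (Icc a b) (φ u) (deriv φ u • (1 : ℝ))
      rw [smul_eq_mul, smul_eq_mul, mul_comm]
    rw [h4]
    exact (hcc (φ u) (hφI u)).smul hφm.deriv_nonneg
  · rw [Function.comp_apply, hφ]
    simp [Real.smoothTransition.zero_of_nonpos (show 3 * u - 1 ≤ 0 by linarith)]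
  · rw [Function.comp_apply, hφ]
    simp [Real.smoothTransition.one_of_one_le (show 1 ≤ 3 * u - 1 by linarith)]

/-- A causal chain of points lies on a causal line. -/
theorem exists_isCausalLine_chain {z : ℕ → M} (hz : ∀ n, z (n + 1) ∈ g.causalFuture T (z n)) :
    ∃ c : ℝ → M, g.IsCausalLine T c ∧ ∀ n : ℕ, c n = z n := by
  choose C hC hC0 hC1 using fun n ↦ exists_isCausalLine (hz n)
  -- Resting for a third of a unit at each end makes the `n`-th piece agree with its neighbours
  -- beyond `[n, n + 1]`, which yields smoothness at the integers.
  have key : ∀ (n : ℕ) (u : ℝ), (n : ℝ) - 1 / 3 < u → u < n + 4 / 3 →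
      C ⌊u⌋₊ (u - ⌊u⌋₊) = C n (u - n) := by
    intro n u h1 h2
    rcases lt_or_ge u n with h | h
    · cases n with
      | zero =>
        rw [Nat.floor_eq_zero.2 (by push_cast at h; linarith)]
      | succ k =>
        push_cast at h1 h h2 ⊢
        have hk : (0 : ℝ) ≤ k := k.cast_nonneg
        rw [(Nat.floor_eq_iff (show 0 ≤ u by linarith)).2 ⟨by linarith, h⟩,
          hC1 k _ (by linarith), hC0 (k + 1) _ (by linarith)]
    · have hn : (0 : ℝ) ≤ n := n.cast_nonneg
      rcases lt_or_ge u (n + 1) with h' | h'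
      · rw [(Nat.floor_eq_iff (show 0 ≤ u by linarith)).2 ⟨h, h'⟩]
      · rw [(Nat.floor_eq_iff (n := n + 1) (show 0 ≤ u by linarith)).2
          ⟨by push_cast; linarith, by push_cast; linarith⟩, hC1 n _ (by linarith),
          hC0 (n + 1) _ (by push_cast; linarith)]
  refine ⟨fun u ↦ C ⌊u⌋₊ (u - ⌊u⌋₊), isCausalLine_of_eventuallyEq fun u ↦
    ⟨C ⌊u⌋₊, ⌊u⌋₊, hC _, ?_⟩, fun n ↦ ?_⟩
  · rcases lt_or_ge u 0 with h | h
    · rw [Nat.floor_of_nonpos h.le]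
      filter_upwards [gt_mem_nhds h] with v hv
      rw [Nat.floor_of_nonpos hv.le]
    · have h1 := Nat.floor_le h
      have h2 := Nat.lt_floor_add_one u
      filter_upwards [Ioo_mem_nhds (show (⌊u⌋₊ : ℝ) - 1 / 3 < u by linarith)
        (show u < ⌊u⌋₊ + 4 / 3 by linarith)] with v hv
      exact key _ v hv.1 hv.2
  · simp only [Nat.floor_natCast, sub_self]
    exact hC0 n 0 (by norm_num)

theorem mem_causalFuture_trans {x y z : M} (hxy : y ∈ g.causalFuture T x)
    (hyz : z ∈ g.causalFuture T y) : z ∈ g.causalFuture T x := by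
  obtain ⟨c, hc, hcz⟩ := exists_isCausalLine_chain (g := g) (T := T)
    (z := fun n ↦ if n = 0 then x else if n = 1 then y else z) (fun n ↦ by
      rcases n with _ | _ | n
      · simpa using hxy
      · simpa using hyz
      · simpa using mem_causalFuture_self z)
  have h := hc.mem_causalFuture (show (0 : ℝ) ≤ 2 by norm_num)
  have h0 := hcz 0
  have h2 := hcz 2
  simp only [Nat.cast_zero, Nat.cast_ofNat] at h0 h2
  rw [h0, h2] at h
  simpa using h

end LorentzMetric

/-! ### The metric and the time function in a chart. -/

namespace LorentzMetric

variable {m : ℕ} {M : Type*} [TopologicalSpace M]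
  [ChartedSpace (EuclideanSpace ℝ (Fin (m + 1))) M] [IsManifold (𝓡 (m + 1)) ∞ M]

/-- The derivative of the inverse of the chart at `x`. -/
def chartDeriv (x : M) (y : EuclideanSpace ℝ (Fin (m + 1))) :
    EuclideanSpace ℝ (Fin (m + 1)) →L[ℝ]
      TangentSpace (𝓡 (m + 1)) ((chartAt (EuclideanSpace ℝ (Fin (m + 1))) x).symm y) :=
  mfderiv (𝓡 (m + 1)) (𝓡 (m + 1)) (chartAt (EuclideanSpace ℝ (Fin (m + 1))) x).symm y

/-- The metric in the chart at `x`. -/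
def chartMetric (g : LorentzMetric m M) (x : M) (y : EuclideanSpace ℝ (Fin (m + 1))) :
    EuclideanSpace ℝ (Fin (m + 1)) →L[ℝ] EuclideanSpace ℝ (Fin (m + 1)) →L[ℝ] ℝ :=
  ContinuousLinearMap.bilinearComp (E := EuclideanSpace ℝ (Fin (m + 1)))
    (F := EuclideanSpace ℝ (Fin (m + 1)))
    (g.inner ((chartAt (EuclideanSpace ℝ (Fin (m + 1))) x).symm y)) (chartDeriv x y)
    (chartDeriv x y)

theorem chartMetric_apply (g : LorentzMetric m M) (x : M)
    (y v w : EuclideanSpace ℝ (Fin (m + 1))) :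
    g.chartMetric x y v w = g.inner ((chartAt (EuclideanSpace ℝ (Fin (m + 1))) x).symm y)
      (chartDeriv x y v) (chartDeriv x y w) := rfl

theorem mdifferentiableAt_chart_symm (x : M) {y : EuclideanSpace ℝ (Fin (m + 1))}
    (hy : y ∈ (chartAt (EuclideanSpace ℝ (Fin (m + 1))) x).target) :
    MDifferentiableAt (𝓡 (m + 1)) (𝓡 (m + 1))
      (chartAt (EuclideanSpace ℝ (Fin (m + 1))) x).symm y :=
  mdifferentiableAt_atlas_symm (chart_mem_atlas _ x) hy

theorem chartDeriv_bijective (x : M) {y : EuclideanSpace ℝ (Fin (m + 1))}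
    (hy : y ∈ (chartAt (EuclideanSpace ℝ (Fin (m + 1))) x).target) :
    Function.Bijective (chartDeriv x y) :=
  (mdifferentiable_chart (I := 𝓡 (m + 1)) x).symm.mfderiv_bijective hy

/-- It suffices to treat the coefficients on fixed `v` and `w`. These are the smooth tensor
evaluated on the images of constant fields under the tangent map of the inverse chart. -/
theorem contDiffOn_chartMetric (g : LorentzMetric m M) (x : M) :
    ContDiffOn ℝ ∞ (g.chartMetric x) (chartAt (EuclideanSpace ℝ (Fin (m + 1))) x).target := by
  set φ := chartAt (EuclideanSpace ℝ (Fin (m + 1))) x with hφ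
  have hsymm : ContMDiffOn (𝓡 (m + 1)) (𝓡 (m + 1)) ∞ φ.symm φ.target := contMDiffOn_chart_symm
  have hfield : ∀ v : EuclideanSpace ℝ (Fin (m + 1)),
      ContMDiffOn (𝓡 (m + 1)) (𝓡 (m + 1)).tangent ∞
        (fun y ↦ (⟨φ.symm y, chartDeriv x y v⟩ : TangentBundle (𝓡 (m + 1)) M)) φ.target := by
    intro v
    have h1 := hsymm.contMDiffOn_tangentMapWithin (m := ∞) (by simp)
      φ.open_target.uniqueMDiffOn
    have h2 : ContMDiffOn (𝓡 (m + 1)) (𝓡 (m + 1)).tangent ∞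
        (fun y ↦ (⟨y, v⟩ : TangentBundle (𝓡 (m + 1)) (EuclideanSpace ℝ (Fin (m + 1)))))
        φ.target :=
      contMDiffOn_vectorSpace_iff_contDiffOn.2 contDiffOn_const
    refine (h1.comp h2 fun y hy ↦ hy).congr fun y hy ↦ ?_
    simp only [Function.comp_apply, tangentMapWithin]
    rw [mfderivWithin_of_isOpen φ.open_target hy]
    rfl
  rw [contDiffOn_clm_apply]
  intro v
  rw [contDiffOn_clm_apply]
  intro w
  rw [← contMDiffOn_iff_contDiffOn]
  intro y hy
  have h3 : ContMDiffWithinAt (𝓡 (m + 1)) ((𝓡 (m + 1)).prod 𝓘(ℝ, ℝ)) ∞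
      (fun y ↦ TotalSpace.mk' ℝ (E := Bundle.Trivial M ℝ) (φ.symm y)
        (g.inner (φ.symm y) (chartDeriv x y v) (chartDeriv x y w))) φ.target y := by
    apply ContMDiffWithinAt.clm_bundle_apply₂ (F₁ := EuclideanSpace ℝ (Fin (m + 1)))
      (F₂ := EuclideanSpace ℝ (Fin (m + 1)))
    · exact ContMDiffAt.comp_contMDiffWithinAt y g.contMDiff.contMDiffAt (hsymm y hy)
    · exact hfield v y hy
    · exact hfield w y hy
  simp only [contMDiffWithinAt_totalSpace] at h3
  exact h3.2

/-- The differential of `t` in the chart at `x`. -/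
def chartSlope (t : M → ℝ) (x : M) (y : EuclideanSpace ℝ (Fin (m + 1))) :
    EuclideanSpace ℝ (Fin (m + 1)) →L[ℝ] ℝ :=
  fderiv ℝ (t ∘ (chartAt (EuclideanSpace ℝ (Fin (m + 1))) x).symm) y

theorem chartSlope_apply (g : LorentzMetric m M) {t : M → ℝ}
    (ht : ContMDiff (𝓡 (m + 1)) 𝓘(ℝ, ℝ) ∞ t) (x : M) {y : EuclideanSpace ℝ (Fin (m + 1))}
    (hy : y ∈ (chartAt (EuclideanSpace ℝ (Fin (m + 1))) x).target)
    (v : EuclideanSpace ℝ (Fin (m + 1))) :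
    chartSlope t x y v = g.inner ((chartAt (EuclideanSpace ℝ (Fin (m + 1))) x).symm y)
      (g.grad t ((chartAt (EuclideanSpace ℝ (Fin (m + 1))) x).symm y)) (chartDeriv x y v) := by
  rw [g.inner_grad]
  have h1 := HasMFDerivAt.comp y ((ht _).mdifferentiableAt (by simp)).hasMFDerivAt
    (mdifferentiableAt_chart_symm x hy).hasMFDerivAt
  have h2 := h1.mfderiv
  rw [mfderiv_eq_fderiv] at h2
  rw [chartSlope, h2]
  rfl

theorem contDiffOn_comp_chart_symm {t : M → ℝ} (ht : ContMDiff (𝓡 (m + 1)) 𝓘(ℝ, ℝ) ∞ t) (x : M) :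
    ContDiffOn ℝ ∞ (t ∘ (chartAt (EuclideanSpace ℝ (Fin (m + 1))) x).symm)
      (chartAt (EuclideanSpace ℝ (Fin (m + 1))) x).target := by
  rw [← contMDiffOn_iff_contDiffOn]
  exact ht.comp_contMDiffOn contMDiffOn_chart_symm

theorem continuousOn_chartSlope {t : M → ℝ} (ht : ContMDiff (𝓡 (m + 1)) 𝓘(ℝ, ℝ) ∞ t) (x : M) :
    ContinuousOn (chartSlope t x) (chartAt (EuclideanSpace ℝ (Fin (m + 1))) x).target :=
  (contDiffOn_comp_chart_symm ht x).continuousOn_fderiv_of_isOpen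
    (chartAt (EuclideanSpace ℝ (Fin (m + 1))) x).open_target (by simp)

-- The orienting covector is `dt = ⟨grad t, ·⟩`, so the axioms are the linear algebra above with `N
-- = grad t`, and `-grad t` is the timelike vector.
set_option maxHeartbeats 1000000 in
theorem IsTimeFunction.isFlatLorentz {g : LorentzMetric m M} {t : M → ℝ} (ht : g.IsTimeFunction t)
    (x : M) : IsFlatLorentz (g.chartMetric x) (chartSlope t x)
      (chartAt (EuclideanSpace ℝ (Fin (m + 1))) x).target where
  isOpen := (chartAt (EuclideanSpace ℝ (Fin (m + 1))) x).open_target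
  contDiffOn := g.contDiffOn_chartMetric x
  symm y _ v w := g.symm _ _ _
  nondeg y hy v hv := by
    refine (map_eq_zero_iff _ (chartDeriv_bijective x hy).1).1
      (g.eq_zero_of_inner_eq_zero _ _ fun w ↦ ?_)
    obtain ⟨w, rfl⟩ := (chartDeriv_bijective x hy).2 w
    exact hv w
  continuousOn := continuousOn_chartSlope ht.1 x
  eq_zero y hy v hv h0 := by
    rw [g.chartSlope_apply ht.1 x hy] at h0
    exact (map_eq_zero_iff _ (chartDeriv_bijective x hy).1).1
      (g.eq_zero_of_orthogonal (ht.2 _) hv h0)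
  cone y hy v w hv hw hv' hw' := by
    rw [g.chartSlope_apply ht.1 x hy] at hv' hw'
    exact g.inner_nonpos_of_causal (ht.2 _) hv hw hv' hw'
  exists_timelike y hy := by
    obtain ⟨v, hv⟩ := (chartDeriv_bijective x hy).2 (-g.grad t _)
    have h := ht.2 ((chartAt (EuclideanSpace ℝ (Fin (m + 1))) x).symm y)
    rw [IsTimelike] at h
    refine ⟨v, ?_, ?_⟩
    · rw [chartMetric_apply, hv]
      simpa using h
    · rw [g.chartSlope_apply ht.1 x hy, hv]
      simpa using h

theorem IsTimeFunction.flatCausal_iff {g : LorentzMetric m M} {t : M → ℝ}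
    (ht : g.IsTimeFunction t) (x : M) {y : EuclideanSpace ℝ (Fin (m + 1))}
    (hy : y ∈ (chartAt (EuclideanSpace ℝ (Fin (m + 1))) x).target)
    (v : EuclideanSpace ℝ (Fin (m + 1))) :
    FlatCausal (g.chartMetric x) (chartSlope t x) y v ↔
      g.IsFutureCausal (fun x ↦ -g.grad t x) (chartDeriv x y v) := by
  rw [isFutureCausal_neg_grad_iff, FlatCausal, chartMetric_apply, g.chartSlope_apply ht.1 x hy,
    Ne, Ne, map_eq_zero_iff _ (chartDeriv_bijective x hy).1]

end LorentzMetric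

/-! ### Transfer of the local causal relation to the manifold. -/

namespace LorentzMetric

variable {m : ℕ} {M : Type*} [TopologicalSpace M]
  [ChartedSpace (EuclideanSpace ℝ (Fin (m + 1))) M] [IsManifold (𝓡 (m + 1)) ∞ M]
  {g : LorentzMetric m M} {t : M → ℝ}

theorem hasMFDerivWithinAt_chart_symm_comp (x : M) {γ : ℝ → EuclideanSpace ℝ (Fin (m + 1))}
    {w : EuclideanSpace ℝ (Fin (m + 1))} {s : Set ℝ} {u : ℝ} (hγ : HasDerivWithinAt γ w s u)
    (hu : γ u ∈ (chartAt (EuclideanSpace ℝ (Fin (m + 1))) x).target)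
    (hs : UniqueMDiffWithinAt 𝓘(ℝ, ℝ) s u) :
    mfderivWithin 𝓘(ℝ, ℝ) (𝓡 (m + 1))
      ((chartAt (EuclideanSpace ℝ (Fin (m + 1))) x).symm ∘ γ) s u
        (1 : TangentSpace 𝓘(ℝ, ℝ) u) = chartDeriv x (γ u) w := by
  have h1 := HasMFDerivAt.comp_hasMFDerivWithinAt u
    (mdifferentiableAt_chart_symm x hu).hasMFDerivAt hγ.hasFDerivWithinAt.hasMFDerivWithinAt
  rw [h1.mfderivWithin hs]
  change chartDeriv x (γ u) ((1 : ℝ) • w) = _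
  rw [one_smul]

theorem IsTimeFunction.isFutureCausalCurve_chart_symm (ht : g.IsTimeFunction t) (x : M)
    {γ w : ℝ → EuclideanSpace ℝ (Fin (m + 1))} (hγ : ContDiffOn ℝ ∞ γ (Icc 0 1))
    (h : ∀ u ∈ Icc (0 : ℝ) 1, γ u ∈ (chartAt (EuclideanSpace ℝ (Fin (m + 1))) x).target ∧
      HasDerivWithinAt γ (w u) (Icc 0 1) u ∧
        FlatCausal (g.chartMetric x) (chartSlope t x) (γ u) (w u)) :
    g.IsFutureCausalCurve (fun x ↦ -g.grad t x)
      ((chartAt (EuclideanSpace ℝ (Fin (m + 1))) x).symm ∘ γ) (Icc 0 1) := by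
  refine ⟨contMDiffOn_chart_symm.comp hγ.contMDiffOn fun u hu ↦ (h u hu).1, fun u hu ↦ ?_⟩
  rw [hasMFDerivWithinAt_chart_symm_comp x (h u hu).2.1 (h u hu).1
    ((uniqueDiffOn_Icc zero_lt_one) u hu).uniqueMDiffWithinAt]
  exact (ht.flatCausal_iff x (h u hu).1 (w u)).1 (h u hu).2.2

/-- `t` is monotone along the curve. Equal end values would make it constant, so `dt` would
annihilate the velocity, and a causal vector with this property is zero; the curve would then be
constant. -/
theorem lt_of_flatCausal (ht : ContMDiff (𝓡 (m + 1)) 𝓘(ℝ, ℝ) ∞ t) (x : M)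
    {γ w : ℝ → EuclideanSpace ℝ (Fin (m + 1))}
    (h : ∀ u ∈ Icc (0 : ℝ) 1, γ u ∈ (chartAt (EuclideanSpace ℝ (Fin (m + 1))) x).target ∧
      HasDerivWithinAt γ (w u) (Icc 0 1) u ∧
        FlatCausal (g.chartMetric x) (chartSlope t x) (γ u) (w u)) (hne : γ 0 ≠ γ 1) :
    t ((chartAt (EuclideanSpace ℝ (Fin (m + 1))) x).symm (γ 0)) <
      t ((chartAt (EuclideanSpace ℝ (Fin (m + 1))) x).symm (γ 1)) := by
  set φ := chartAt (EuclideanSpace ℝ (Fin (m + 1))) x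
  set f : ℝ → ℝ := fun u ↦ (t ∘ φ.symm) (γ u)
  have hf : ∀ u ∈ Icc (0 : ℝ) 1,
      HasDerivWithinAt f (chartSlope t x (γ u) (w u)) (Icc 0 1) u := fun u hu ↦ by
    have h1 : HasFDerivAt (t ∘ φ.symm) (chartSlope t x (γ u)) (γ u) :=
      (((contDiffOn_comp_chart_symm ht x).contDiffAt
        (φ.open_target.mem_nhds (h u hu).1)).differentiableAt (by simp)).hasFDerivAt
    exact h1.comp_hasDerivWithinAt u (h u hu).2.1
  have hmono : MonotoneOn f (Icc 0 1) :=
    monotoneOn_of_hasDerivWithinAt_nonneg (convex_Icc 0 1)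
      (fun u hu ↦ (hf u hu).continuousWithinAt)
      (fun u hu ↦ (hf u (interior_subset hu)).mono interior_subset)
      fun u hu ↦ (h u (interior_subset hu)).2.2.nonneg
  have h0 : (0 : ℝ) ∈ Icc (0 : ℝ) 1 := left_mem_Icc.2 zero_le_one
  have h1 : (1 : ℝ) ∈ Icc (0 : ℝ) 1 := right_mem_Icc.2 zero_le_one
  by_contra hlt
  have hconst : ∀ u ∈ Icc (0 : ℝ) 1, f u = f 0 := fun u hu ↦
    le_antisymm ((hmono hu h1 hu.2).trans (not_lt.1 hlt)) (hmono h0 hu hu.1)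
  have hw : ∀ u ∈ Icc (0 : ℝ) 1, w u = 0 := fun u hu ↦ by
    by_contra hwu
    have h2 := (hf u hu).congr (f₁ := fun _ ↦ f 0) (fun v hv ↦ (hconst v hv).symm)
      (hconst u hu).symm
    have h3 := ((uniqueDiffOn_Icc zero_lt_one) u hu).eq_deriv _ h2
      (hasDerivWithinAt_const u (Icc (0 : ℝ) 1) (f 0))
    exact ((h u hu).2.2.2 hwu).ne' h3
  have h4 := (convex_Icc (0 : ℝ) 1).norm_image_sub_le_of_norm_hasDerivWithin_le (C := 0)
    (fun u hu ↦ (h u hu).2.1) (fun u hu ↦ by simp [hw u hu]) h0 h1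
  rw [zero_mul, norm_le_zero_iff, sub_eq_zero] at h4
  exact hne h4.symm

/-- A causal line in the domain of a chart is causal in the chart. -/
theorem IsCausalLine.exists_hasDerivAt_chart (ht : g.IsTimeFunction t) {c : ℝ → M}
    (hc : g.IsCausalLine (fun x ↦ -g.grad t x) c) (x : M) {u : ℝ}
    (hu : c u ∈ (chartAt (EuclideanSpace ℝ (Fin (m + 1))) x).source) :
    HasDerivAt (chartAt (EuclideanSpace ℝ (Fin (m + 1))) x ∘ c)
      (deriv (chartAt (EuclideanSpace ℝ (Fin (m + 1))) x ∘ c) u) u ∧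
    FlatCausal (g.chartMetric x) (chartSlope t x) (chartAt (EuclideanSpace ℝ (Fin (m + 1))) x (c u))
      (deriv (chartAt (EuclideanSpace ℝ (Fin (m + 1))) x ∘ c) u) := by
  set φ := chartAt (EuclideanSpace ℝ (Fin (m + 1))) x
  have h1 : MDifferentiableAt 𝓘(ℝ, ℝ) (𝓡 (m + 1)) (φ ∘ c) u :=
    (mdifferentiableAt_atlas (chart_mem_atlas _ x) hu).comp u
      ((hc.1 u).mdifferentiableAt (by simp))
  have h2 : HasDerivAt (φ ∘ c) (deriv (φ ∘ c) u) u :=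
    (mdifferentiableAt_iff_differentiableAt.1 h1).hasDerivAt
  refine ⟨h2, ?_⟩
  rw [ht.flatCausal_iff x (φ.map_source hu)]
  have h3 : c =ᶠ[𝓝 u] φ.symm ∘ (φ ∘ c) := by
    filter_upwards [hc.1.continuous.continuousAt.preimage_mem_nhds (φ.open_source.mem_nhds hu)]
      with v hv using (φ.left_inv hv).symm
  have h4 := hasMFDerivWithinAt_chart_symm_comp x (h2.hasDerivWithinAt (s := univ))
    (φ.map_source hu) (uniqueMDiffWithinAt_univ 𝓘(ℝ, ℝ))
  rw [mfderivWithin_univ, ← h3.mfderiv_eq] at h4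
  exact (isFutureCausal_congr h3.self_of_nhds h4).1 (hc.2 u)

/-- Every point has a compact neighbourhood in which the causal relation is closed. -/
theorem IsTimeFunction.exists_local_causal_relation [T2Space M] (ht : g.IsTimeFunction t) (x : M) :
    ∃ B : Set M, IsCompact B ∧ B ∈ 𝓝 x ∧ ∃ N : Set (M × M), IsClosed N ∧ N ⊆ B ×ˢ B ∧
      (∀ p q, (p, q) ∈ N →
        q ∈ g.causalFuture (fun x ↦ -g.grad t x) p ∧ (p ≠ q → t p < t q)) ∧
      ∀ (c : ℝ → M) (a b : ℝ), g.IsCausalLine (fun x ↦ -g.grad t x) c → a ≤ b →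
        (∀ u ∈ Icc a b, c u ∈ B) → (c a, c b) ∈ N := by
  set φ := chartAt (EuclideanSpace ℝ (Fin (m + 1))) x
  have hx : x ∈ φ.source := mem_chart_source _ x
  obtain ⟨r, hr, hrΩ, N, hN, hNB, hN1, hN2⟩ :=
    (ht.isFlatLorentz x).exists_local_causal_relation (φ.map_source hx)
  set K := Metric.closedBall (φ x) r
  have hK : IsCompact K := isCompact_closedBall _ _
  have hcont : ContinuousOn φ.symm K := φ.continuousOn_symm.mono hrΩ
  have hNc : IsCompact N := (hK.prod hK).of_isClosed_subset hN hNB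
  refine ⟨φ.symm '' K, hK.image_of_continuousOn hcont, ?_, Prod.map φ.symm φ.symm '' N,
    (hNc.image_of_continuousOn ((hcont.prodMap hcont).mono hNB)).isClosed, ?_, ?_, ?_⟩
  · have h1 := φ.symm.map_nhds_eq (φ.map_source hx)
    rw [φ.left_inv hx] at h1
    rw [← h1]
    exact image_mem_map (Metric.closedBall_mem_nhds _ hr)
  · rintro _ ⟨⟨p, q⟩, hpq, rfl⟩
    exact ⟨mem_image_of_mem _ (hNB hpq).1, mem_image_of_mem _ (hNB hpq).2⟩
  · rintro _ _ ⟨⟨p, q⟩, hpq, h⟩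
    obtain ⟨rfl, rfl⟩ := Prod.mk.inj h
    obtain ⟨γ, w, rfl, rfl, hγ, hγw⟩ := hN1 p q hpq
    refine ⟨⟨φ.symm ∘ γ, 0, 1, zero_lt_one, ht.isFutureCausalCurve_chart_symm x hγ hγw, rfl, rfl⟩,
      fun hne ↦ lt_of_flatCausal ht.1 x hγw fun h ↦ hne (by rw [h])⟩
  · intro c a b hc hab hcB
    have hsrc : ∀ u ∈ Icc a b, c u ∈ φ.source ∧ φ (c u) ∈ K := fun u hu ↦ by
      obtain ⟨y, hy, hyu⟩ := hcB u hu
      rw [← hyu, φ.right_inv (hrΩ hy)]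
      exact ⟨φ.map_target (hrΩ hy), hy⟩
    refine ⟨(φ (c a), φ (c b)), hN2 a b (φ ∘ c) (deriv (φ ∘ c)) hab fun u hu ↦ ?_, ?_⟩
    · have h1 := hc.exists_hasDerivAt_chart ht x (hsrc u hu).1
      exact ⟨h1.1.hasDerivWithinAt, (hsrc u hu).2, h1.2⟩
    · rw [Prod.map_apply, φ.left_inv (hsrc a (left_mem_Icc.2 hab)).1,
        φ.left_inv (hsrc b (right_mem_Icc.2 hab)).1]

end LorentzMetric

/-! ### Inextendible causal lines and compactness up to a time slice. -/

namespace LorentzMetric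

variable {m : ℕ} {M : Type*} [TopologicalSpace M]
  [ChartedSpace (EuclideanSpace ℝ (Fin (m + 1))) M] [IsManifold (𝓡 (m + 1)) ∞ M]
  {g : LorentzMetric m M} {t : M → ℝ}

theorem IsCausalLine.monotone (ht : ContMDiff (𝓡 (m + 1)) 𝓘(ℝ, ℝ) ∞ t) {c : ℝ → M}
    (hc : g.IsCausalLine (fun x ↦ -g.grad t x) c) : Monotone (t ∘ c) := by
  have h1 : ∀ u, HasDerivAt (t ∘ c) (g.inner (c u) (g.grad t (c u))
      (mfderiv 𝓘(ℝ, ℝ) (𝓡 (m + 1)) c u (1 : TangentSpace 𝓘(ℝ, ℝ) u))) u := by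
    intro u
    rw [g.inner_grad]
    have h2 := HasMFDerivAt.comp u ((ht (c u)).mdifferentiableAt (by simp)).hasMFDerivAt
      ((hc.1 u).mdifferentiableAt (by simp)).hasMFDerivAt
    have h3 : HasFDerivAt (t ∘ c) (show ℝ →L[ℝ] ℝ from
      (mfderiv (𝓡 (m + 1)) 𝓘(ℝ, ℝ) t (c u)).comp (mfderiv 𝓘(ℝ, ℝ) (𝓡 (m + 1)) c u)) u :=
      hasMFDerivAt_iff_hasFDerivAt.1 h2
    exact h3.hasDerivAt
  refine monotone_of_deriv_nonneg (fun u ↦ (h1 u).differentiableAt) fun u ↦ ?_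
  rw [(h1 u).deriv]
  have h2 := (isFutureCausal_neg_grad_iff g).1 (hc.2 u)
  by_cases h0 : mfderiv 𝓘(ℝ, ℝ) (𝓡 (m + 1)) c u (1 : TangentSpace 𝓘(ℝ, ℝ) u) = 0
  · rw [h0, map_zero]
  · exact (h2.2 h0).le

theorem le_of_mem_causalFuture (ht : ContMDiff (𝓡 (m + 1)) 𝓘(ℝ, ℝ) ∞ t) {x y : M}
    (h : y ∈ g.causalFuture (fun x ↦ -g.grad t x) x) : t x ≤ t y := by
  obtain ⟨c, hc, h0, h1⟩ := exists_isCausalLine h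
  have := hc.monotone ht zero_le_one
  simpa only [Function.comp_apply, h0 0 (by norm_num), h1 1 (by norm_num)] using this

/-- Time functions increase strictly towards some causal future point. -/
theorem IsTimeFunction.exists_lt (ht : g.IsTimeFunction t) (x : M) :
    ∃ y ∈ g.causalFuture (fun x ↦ -g.grad t x) x, t x < t y := by
  set φ := chartAt (EuclideanSpace ℝ (Fin (m + 1))) x
  have hx : x ∈ φ.source := mem_chart_source _ x
  obtain ⟨e, δ, hδ, κ, hκ, -, h⟩ := (ht.isFlatLorentz x).exists_timelike_cone (φ.map_source hx)
  have hev : ∀ᶠ s : ℝ in 𝓝 0, φ x + s • e ∈ Metric.ball (φ x) δ ∩ φ.target := by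
    have h1 : Continuous fun s : ℝ ↦ φ x + s • e := by fun_prop
    refine h1.continuousAt.eventually_mem ?_
    rw [zero_smul, add_zero]
    exact inter_mem (Metric.ball_mem_nhds _ hδ) (φ.open_target.mem_nhds (φ.map_source hx))
  obtain ⟨η, hη, hev⟩ := Metric.eventually_nhds_iff.1 hev
  have hη2 : 0 < η / 2 := by positivity
  have hγ : ∀ u ∈ Icc (0 : ℝ) 1, φ x + u • (η / 2) • e ∈ φ.target ∧
      HasDerivWithinAt (fun u : ℝ ↦ φ x + u • (η / 2) • e) ((η / 2) • e) (Icc 0 1) u ∧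
      FlatCausal (g.chartMetric x) (chartSlope t x) (φ x + u • (η / 2) • e) ((η / 2) • e) := by
    intro u hu
    have h1 : φ x + u • (η / 2) • e ∈ Metric.ball (φ x) δ ∩ φ.target := by
      rw [smul_smul]
      refine hev ?_
      rw [Real.dist_0_eq_abs, abs_of_nonneg (mul_nonneg hu.1 hη2.le)]
      nlinarith [hu.2]
    have h2 := h _ h1.1 (η / 2) hη2 ((η / 2) • e) (by
      rw [sub_self, norm_zero]
      positivity)
    have h3 := ((hasDerivWithinAt_id u (Icc (0 : ℝ) 1)).smul_const ((η / 2) • e)).const_add (φ x)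
    rw [one_smul] at h3
    exact ⟨h1.2, h3, h2.1.le, fun _ ↦ h2.2⟩
  have he : e ≠ 0 := by
    rintro rfl
    have := h (φ x) (Metric.mem_ball_self hδ) 1 one_pos 0 (by simp)
    simp at this
  have hγs : ContDiffOn ℝ ∞ (fun u : ℝ ↦ φ x + u • (η / 2) • e) (Icc 0 1) :=
    (contDiff_const.add (contDiff_id.smul contDiff_const)).contDiffOn
  refine ⟨φ.symm (φ x + (1 : ℝ) • (η / 2) • e), ⟨_, 0, 1, zero_lt_one,
    ht.isFutureCausalCurve_chart_symm x hγs hγ, ?_, rfl⟩, ?_⟩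
  · change φ.symm (φ x + (0 : ℝ) • (η / 2) • e) = x
    rw [zero_smul, add_zero, φ.left_inv hx]
  · have h1 : t (φ.symm (φ x + (0 : ℝ) • (η / 2) • e)) <
        t (φ.symm (φ x + (1 : ℝ) • (η / 2) • e)) :=
      lt_of_flatCausal (g := g) ht.1 x hγ (by simp [he, hη.ne'])
    rwa [zero_smul, add_zero, φ.left_inv hx] at h1

/-- A causal line starting in a closed set either stays there or passes through the frontier. -/
theorem mem_or_exists_frontier {T : (x : M) → TangentSpace (𝓡 (m + 1)) x} {B : Set M}
    (hB : IsClosed B) {N : Set (M × M)}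
    (hN : ∀ (c : ℝ → M) (a b : ℝ), g.IsCausalLine T c → a ≤ b → (∀ u ∈ Icc a b, c u ∈ B) →
      (c a, c b) ∈ N) {x y : M} (hx : x ∈ B) (hxy : y ∈ g.causalFuture T x) :
    (x, y) ∈ N ∨ ∃ z ∈ frontier B, (x, z) ∈ N ∧ y ∈ g.causalFuture T z := by
  obtain ⟨c, hc, h0, h1⟩ := exists_isCausalLine hxy
  obtain rfl : c 0 = x := h0 0 (by norm_num)
  obtain rfl : c 1 = y := h1 1 (by norm_num)
  by_cases hall : ∀ u ∈ Icc (0 : ℝ) 1, c u ∈ B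
  · exact Or.inl (hN c 0 1 hc zero_le_one hall)
  right
  push Not at hall
  obtain ⟨v, hv, hvB⟩ := hall
  -- The infimum of `S` is the first exit time: the curve is in `B` up to and including it, and
  -- outside `B` at parameters arbitrarily close to it.
  set S := {u ∈ Icc (0 : ℝ) v | c u ∉ B}
  have hSne : S.Nonempty := ⟨v, right_mem_Icc.2 hv.1, hvB⟩
  have hSb : BddBelow S := ⟨0, fun u hu ↦ hu.1.1⟩
  set s := sInf S
  have hs0 : 0 ≤ s := le_csInf hSne fun u hu ↦ hu.1.1
  have hsv : s ≤ v := csInf_le hSb ⟨right_mem_Icc.2 hv.1, hvB⟩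
  have hlt : ∀ u, 0 ≤ u → u < s → c u ∈ B := fun u hu hus ↦ by
    by_contra hn
    exact absurd (csInf_le hSb ⟨⟨hu, hus.le.trans hsv⟩, hn⟩) (not_le.2 hus)
  have hsB : c s ∈ B := by
    rcases hs0.eq_or_lt with h | h
    · rwa [← h]
    · have h1 : ∀ᶠ u in 𝓝[<] s, c u ∈ B := by
        filter_upwards [Ioo_mem_nhdsLT h] with u hu using hlt u hu.1.le hu.2
      exact hB.mem_of_tendsto (hc.1.continuous.continuousAt.tendsto.mono_left nhdsWithin_le_nhds)
        h1
  have hsub : ∀ u ∈ Icc 0 s, c u ∈ B := fun u hu ↦ by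
    rcases hu.2.eq_or_lt with h | h
    · rwa [h]
    · exact hlt u hu.1 h
  refine ⟨c s, ⟨subset_closure hsB, fun hint ↦ ?_⟩, hN c 0 s hc hs0 hsub,
    hc.mem_causalFuture (hsv.trans hv.2)⟩
  have h1 : ∀ᶠ u in 𝓝 s, c u ∈ B :=
    hc.1.continuous.continuousAt.eventually_mem (mem_interior_iff_mem_nhds.1 hint)
  have h2 : s ∈ closure S := csInf_mem_closure hSne hSb
  obtain ⟨u, hu1, hu2⟩ := mem_closure_iff_nhds.1 h2 _ h1
  exact hu2.2 hu1

/-- If a causal line converges, its limit lies in the causal future of all its points. -/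
theorem IsCausalLine.limit_mem_causalFuture [T2Space M] (ht : g.IsTimeFunction t) {c : ℝ → M}
    (hc : g.IsCausalLine (fun x ↦ -g.grad t x) c) {q : M} (hq : Tendsto c atTop (𝓝 q)) (u : ℝ) :
    q ∈ g.causalFuture (fun x ↦ -g.grad t x) (c u) := by
  obtain ⟨B, -, hB, N, hN, -, hN1, hN2⟩ := ht.exists_local_causal_relation q
  obtain ⟨U, hU⟩ := eventually_atTop.1 (hq.eventually hB)
  set k := max u U
  have h1 : (c k, q) ∈ N := by
    refine hN.mem_of_tendsto (tendsto_const_nhds.prodMk_nhds hq) ?_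
    filter_upwards [eventually_ge_atTop k] with v hv
    exact hN2 c k v hc hv fun s hs ↦ hU s ((le_max_right _ _).trans hs.1)
  exact mem_causalFuture_trans (hc.mem_causalFuture (le_max_left _ _)) (hN1 _ _ h1).1

/-- If one can always move strictly to the future within a closed set, then there is an inextendible
causal line in the causal past of this set. -/
theorem IsTimeFunction.exists_inextendible [T2Space M] (ht : g.IsTimeFunction t) {L : Set M}
    (hL : IsClosed L) {p : M} (hp : p ∈ L)
    (hstep : ∀ x ∈ L, x ∈ g.causalFuture (fun x ↦ -g.grad t x) p →
      ∃ y ∈ L, y ∈ g.causalFuture (fun x ↦ -g.grad t x) x ∧ t x < t y) :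
    ∃ c : ℝ → M, g.IsCausalLine (fun x ↦ -g.grad t x) c ∧ c 0 = p ∧
      (∀ u ≥ 0, ∃ z ∈ L, z ∈ g.causalFuture (fun x ↦ -g.grad t x) p ∧
        z ∈ g.causalFuture (fun x ↦ -g.grad t x) (c u)) ∧
      ¬ ∃ q, Tendsto c atTop (𝓝 q) := by
  set J := g.causalFuture fun x ↦ -g.grad t x
  -- `arctan` makes the time bounded, and `y` gains more than half of the available increase.
  have hbest : ∀ x : {x // x ∈ L ∧ x ∈ J p}, ∃ y : {x // x ∈ L ∧ x ∈ J p}, y.1 ∈ J x.1 ∧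
      ∀ z ∈ L, z ∈ J x.1 →
        Real.arctan (t z) ≤ 2 * Real.arctan (t y.1) - Real.arctan (t x.1) := by
    rintro ⟨x, hxL, hxp⟩
    set S := (fun z ↦ Real.arctan (t z)) '' (L ∩ J x)
    have hSb : BddAbove S := ⟨Real.pi / 2, by
      rintro _ ⟨z, -, rfl⟩
      exact (Real.arctan_lt_pi_div_two _).le⟩
    obtain ⟨y, hyL, hyx, hlt⟩ := hstep x hxL hxp
    have hxS : Real.arctan (t x) < sSup S :=
      (Real.arctan_strictMono hlt).trans_le (le_csSup hSb ⟨y, ⟨hyL, hyx⟩, rfl⟩)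
    obtain ⟨_, ⟨z, ⟨hzL, hzx⟩, rfl⟩, hz⟩ := exists_lt_of_lt_csSup (s := S)
      (Set.Nonempty.image _ ⟨y, hyL, hyx⟩)
      (show (Real.arctan (t x) + sSup S) / 2 < sSup S by linarith)
    refine ⟨⟨z, hzL, mem_causalFuture_trans hxp hzx⟩, hzx, fun z' hz' hz'x ↦ ?_⟩
    have := le_csSup hSb ⟨z', ⟨hz', hz'x⟩, rfl⟩
    dsimp only at hz this ⊢
    linarith
  choose next hnext hopt using hbest
  let z : ℕ → {x // x ∈ L ∧ x ∈ J p} := fun n ↦ next^[n] ⟨p, hp, mem_causalFuture_self p⟩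
  have hz : ∀ n, z (n + 1) = next (z n) := fun n ↦ Function.iterate_succ_apply' _ _ _
  obtain ⟨c, hc, hcz⟩ := exists_isCausalLine_chain (g := g) (T := fun x ↦ -g.grad t x)
    (z := fun n ↦ (z n).1) fun n ↦ by
      rw [hz]
      exact hnext _
  refine ⟨c, hc, by simpa [z] using hcz 0, fun u hu ↦ ?_, ?_⟩
  · refine ⟨(z ⌈u⌉₊).1, (z ⌈u⌉₊).2.1, (z ⌈u⌉₊).2.2, ?_⟩
    rw [← hcz]
    exact hc.mem_causalFuture (Nat.le_ceil u)
  · rintro ⟨q, hq⟩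
    have hzq : Tendsto (fun n ↦ (z n).1) atTop (𝓝 q) := by
      have := hq.comp tendsto_natCast_atTop_atTop
      exact this.congr hcz
    have hqL : q ∈ L := hL.mem_of_tendsto hzq (Eventually.of_forall fun n ↦ (z n).2.1)
    have hqz : ∀ n, q ∈ J (z n).1 := fun n ↦ by
      rw [← hcz]
      exact hc.limit_mem_causalFuture ht hq n
    -- A point `y` beyond the limit was available at every stage. The half-gain rule then bounds
    -- `arctan (t y)` by `arctan (t q)` in the limit, a contradiction.
    obtain ⟨y, hyL, hyq, hlt⟩ := hstep q hqL (mem_causalFuture_trans (z 0).2.2 (hqz 0))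
    have hs : Tendsto (fun n ↦ Real.arctan (t (z n).1)) atTop (𝓝 (Real.arctan (t q))) :=
      ((Real.continuous_arctan.comp ht.1.continuous).tendsto q).comp hzq
    have hlim : Tendsto (fun n ↦ 2 * Real.arctan (t (z (n + 1)).1) - Real.arctan (t (z n).1)) atTop
        (𝓝 (2 * Real.arctan (t q) - Real.arctan (t q))) :=
      ((hs.comp (tendsto_add_atTop_nat 1)).const_mul 2).sub hs
    have h1 : Real.arctan (t y) ≤ 2 * Real.arctan (t q) - Real.arctan (t q) :=
      ge_of_tendsto' hlim fun n ↦ by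
        rw [hz]
        exact hopt (z n) y hyL (mem_causalFuture_trans (hqz n) hyq)
    have h2 := Real.arctan_strictMono hlt
    linarith

/-- The case `a = 0`, `b = ⊤` of the definition, where convergence as `u → b` is convergence along
`atTop`. -/
theorem IsCausalLine.exists_mem_of_mem_pastDomain {T : (x : M) → TangentSpace (𝓡 (m + 1)) x}
    {c : ℝ → M} (hc : g.IsCausalLine T c) {S : Set M} (h0 : c 0 ∈ g.pastDomain T S)
    (hlim : ¬ ∃ q, Tendsto c atTop (𝓝 q)) : ∃ u ≥ 0, c u ∈ S := by
  have hset : {u : ℝ | (0 : ℝ) ≤ u ∧ (u : EReal) < ⊤} = Ici 0 := by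
    ext u
    simp [EReal.coe_lt_top]
  obtain ⟨u, hu, -, huS⟩ := h0 c 0 ⊤ (EReal.coe_lt_top 0)
    (by rw [hset]; exact hc.isFutureCausalCurve (uniqueDiffOn_Ici 0)) rfl (by
      rintro ⟨q, hq⟩
      refine hlim ⟨q, hq.mono_left ?_⟩
      rw [← tendsto_iff_comap]
      exact tendsto_nhdsWithin_iff.2 ⟨EReal.tendsto_coe_nhds_top_iff.2 tendsto_id,
        Eventually.of_forall fun u ↦ EReal.coe_lt_top u⟩)
  exact ⟨u, hu, huS⟩

theorem neg_grad_neg (g : LorentzMetric m M) (t : M → ℝ) :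
    (fun x ↦ -g.grad (fun x ↦ -t x) x) = fun x ↦ -(-g.grad t x) :=
  funext fun x ↦ by rw [grad_neg]

/-- A point before a time slice is not in the future domain of dependence of the slice. -/
theorem IsTimeFunction.mem_pastDomain [T2Space M] (ht : g.IsTimeFunction t) {a : ℝ} {p : M}
    (hD : p ∈ g.domainOfDependence (fun x ↦ -g.grad t x) (t ⁻¹' {a})) (hpa : t p < a) :
    p ∈ g.pastDomain (fun x ↦ -g.grad t x) (t ⁻¹' {a}) := by
  refine hD.resolve_left fun hF ↦ ?_
  rw [futureDomain, ← neg_grad_neg] at hF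
  -- An inextendible past-directed line from `p` exists. As `t` does not increase along it, it never
  -- reaches the level `a > t p`.
  obtain ⟨c, hc, rfl, -, hlim⟩ := ht.neg.exists_inextendible isClosed_univ (mem_univ p)
    fun x _ _ ↦ by
      obtain ⟨y, hy, hlt⟩ := ht.neg.exists_lt x
      exact ⟨y, mem_univ y, hy, hlt⟩
  obtain ⟨u, hu, huS⟩ := hc.exists_mem_of_mem_pastDomain hF hlim
  have h1 := hc.monotone ht.neg.1 hu
  have h2 : t (c u) = a := huS
  simp only [Function.comp_apply, h2] at h1
  linarith

/-- The causal future of `p`, up to a time slice for which `p` is in the past domain of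
dependence, is compact. -/
theorem IsTimeFunction.isCompact_causalFuture_inter [T2Space M] (ht : g.IsTimeFunction t) {a : ℝ}
    {p : M} (hD : p ∈ g.pastDomain (fun x ↦ -g.grad t x) (t ⁻¹' {a})) :
    IsCompact (g.causalFuture (fun x ↦ -g.grad t x) p ∩ {x | t x ≤ a}) := by
  set J := g.causalFuture fun x ↦ -g.grad t x
  rw [isCompact_iff_ultrafilter_le_nhds]
  intro f hf
  by_contra hno
  have hfK : ∀ᶠ y in (f : Filter M), y ∈ J p ∧ t y ≤ a := le_principal_iff.1 hf
  -- `L` plays the role of the limit curves from `p` to the points of the ultrafilter, without any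
  -- convergence theorem for curves.
  set L := {x : M | ∀ V ∈ 𝓝 x, ∀ᶠ y in (f : Filter M), ∃ w ∈ V, y ∈ J w} with hLdef
  have hLcl : IsClosed L := by
    refine isClosed_of_closure_subset fun x hx V hV ↦ ?_
    obtain ⟨V', hV'V, hV'o, hxV'⟩ := mem_nhds_iff.1 hV
    obtain ⟨x', hx'V, hx'L⟩ := mem_closure_iff.1 hx V' hV'o hxV'
    exact (hx'L V' (hV'o.mem_nhds hx'V)).mono fun y ⟨w, hw, hy⟩ ↦ ⟨w, hV'V hw, hy⟩
  have hpL : p ∈ L := fun V hV ↦ hfK.mono fun y hy ↦ ⟨p, mem_of_mem_nhds hV, hy.1⟩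
  have hLa : ∀ x ∈ L, t x ≤ a := by
    intro x hx
    by_contra hxa
    obtain ⟨y, ⟨w, hw, hyw⟩, -, hya⟩ := ((hx _ ((isOpen_lt continuous_const
      ht.1.continuous).mem_nhds (not_le.1 hxa))).and hfK).exists
    exact absurd ((le_of_mem_causalFuture ht.1 hyw).trans hya) (not_le.2 hw)
  have hstep : ∀ x ∈ L, x ∈ J p → ∃ y ∈ L, y ∈ J x ∧ t x < t y := by
    intro x hxL hxp
    obtain ⟨B, hB, hBx, N, hN, hNB, hN1, hN2⟩ := ht.exists_local_causal_relation x
    -- If the ultrafilter is reached inside `B`, it lives on a compact set and converges to a point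
    -- of the future of `p`, which was excluded. Otherwise the connecting curves leave `B`.
    by_cases hα : ∀ V ∈ 𝓝 x, ∀ᶠ y in (f : Filter M), ∃ w ∈ V, (w, y) ∈ N
    · exfalso
      have hfB : (f : Filter M) ≤ 𝓟 B := le_principal_iff.2
        ((hα univ univ_mem).mono fun y ⟨w, _, hy⟩ ↦ (hNB hy).2)
      obtain ⟨q, -, hq⟩ := hB.ultrafilter_le_nhds f hfB
      have hxq : (x, q) ∈ N := by
        rw [← hN.closure_eq, mem_closure_iff_nhds]
        intro O hO
        obtain ⟨V, hV, W, hW, hVW⟩ := mem_nhds_prod_iff.1 hO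
        obtain ⟨y, ⟨w, hw, hy⟩, hyW⟩ := ((hα V hV).and (hq hW)).exists
        exact ⟨(w, y), hVW ⟨hw, hyW⟩, hy⟩
      exact hno ⟨q, ⟨mem_causalFuture_trans hxp (hN1 _ _ hxq).1,
        le_of_tendsto ((ht.1.continuous.tendsto q).mono_left hq) (hfK.mono fun y hy ↦ hy.2)⟩, hq⟩
    · push Not at hα
      obtain ⟨V₀, hV₀, hα⟩ := hα
      have hα' : ∀ᶠ y in (f : Filter M), ¬ ∃ w ∈ V₀, (w, y) ∈ N :=
        hα.mono fun y hy ⟨w, hw, h⟩ ↦ hy w hw h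
      -- An accumulation point of the exit points. If there were none, finitely many neighbourhoods
      -- would cover the compact frontier and exclude every exit point.
      obtain ⟨z, hzB, hz⟩ : ∃ z ∈ frontier B, ∀ V ∈ 𝓝 x, ∀ W ∈ 𝓝 z, ∀ᶠ y in (f : Filter M),
          ∃ w ∈ V, ∃ z' ∈ W, (w, z') ∈ N ∧ y ∈ J z' := by
        by_contra hnone
        push Not at hnone
        have hfr : IsCompact (frontier B) :=
          hB.of_isClosed_subset isClosed_frontier hB.isClosed.frontier_subset
        obtain ⟨V₁, hV₁, h1⟩ : ∃ V ∈ 𝓝 x, ∀ᶠ y in (f : Filter M),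
            ¬ ∃ w ∈ V, ∃ z' ∈ frontier B, (w, z') ∈ N ∧ y ∈ J z' := by
          refine hfr.induction_on (p := fun s ↦ ∃ V ∈ 𝓝 x, ∀ᶠ y in (f : Filter M),
            ¬ ∃ w ∈ V, ∃ z' ∈ s, (w, z') ∈ N ∧ y ∈ J z') ?_ ?_ ?_ ?_
          · exact ⟨univ, univ_mem, Eventually.of_forall fun y ⟨w, _, z', hz', _⟩ ↦ hz'⟩
          · rintro s s' hss' ⟨V, hV, h⟩
            exact ⟨V, hV, h.mono fun y hy ⟨w, hw, z', hz', h'⟩ ↦ hy ⟨w, hw, z', hss' hz', h'⟩⟩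
          · rintro s s' ⟨V, hV, h⟩ ⟨V', hV', h'⟩
            refine ⟨V ∩ V', inter_mem hV hV', (h.and h').mono ?_⟩
            rintro y ⟨hy, hy'⟩ ⟨w, hw, z', hz' | hz', h''⟩
            · exact hy ⟨w, hw.1, z', hz', h''⟩
            · exact hy' ⟨w, hw.2, z', hz', h''⟩
          · intro z hz
            obtain ⟨V, hV, W, hW, h⟩ := hnone z hz
            exact ⟨W, mem_nhdsWithin_of_mem_nhds hW, V, hV,
              h.mono fun y hy ⟨w, hw, z', hz', h1, h2⟩ ↦ hy w hw z' hz' h1 h2⟩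
        obtain ⟨y, ⟨⟨w, hw, hyw⟩, hy0⟩, hy1⟩ := (((hxL _ (inter_mem (inter_mem hV₀ hV₁) hBx)).and
          hα').and h1).exists
        rcases mem_or_exists_frontier hB.isClosed hN2 hw.2 hyw with h | ⟨z, hz, hwz, hyz⟩
        · exact hy0 ⟨w, hw.1.1, h⟩
        · exact hy1 ⟨w, hw.1.2, z, hz, hwz, hyz⟩
      have hxz : (x, z) ∈ N := by
        rw [← hN.closure_eq, mem_closure_iff_nhds]
        intro O hO
        obtain ⟨V, hV, W, hW, hVW⟩ := mem_nhds_prod_iff.1 hO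
        obtain ⟨y, w, hw, z', hz', h, -⟩ := (hz V hV W hW).exists
        exact ⟨(w, z'), hVW ⟨hw, hz'⟩, h⟩
      have hne : x ≠ z := by
        rintro rfl
        exact hzB.2 (mem_interior_iff_mem_nhds.2 hBx)
      refine ⟨z, fun W hW ↦ ?_, (hN1 _ _ hxz).1, (hN1 _ _ hxz).2 hne⟩
      exact (hz univ univ_mem W hW).mono fun y ⟨w, _, z', hz', _, hy⟩ ↦ ⟨z', hz', hy⟩
  obtain ⟨c, hc, rfl, hcL, hlim⟩ := ht.exists_inextendible hLcl hpL hstep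
  obtain ⟨u, hu, huS⟩ := hc.exists_mem_of_mem_pastDomain hD hlim
  obtain ⟨z, hzL, hzp, hzu⟩ := hcL u hu
  obtain ⟨y, hyL, -, hlt⟩ := hstep z hzL hzp
  have h1 := le_of_mem_causalFuture ht.1 hzu
  have h2 : t (c u) = a := huS
  have h3 := hLa y hyL
  linarith

end LorentzMetric

/-! ### Comparison of time orientations and conclusion. -/

namespace LorentzMetric

variable {m : ℕ} {M : Type*} [TopologicalSpace M]
  [ChartedSpace (EuclideanSpace ℝ (Fin (m + 1))) M] [IsManifold (𝓡 (m + 1)) ∞ M]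
  {g : LorentzMetric m M} {t : M → ℝ} {T : (x : M) → TangentSpace (𝓡 (m + 1)) x}

/-- If `T` and `-grad t` are on the same side, they have the same future-pointing vectors. -/
theorem isFutureCausal_iff_of_pos {x : M} (hN : g.IsTimelike (g.grad t x))
    (hT : g.IsTimelike (T x)) (hpos : 0 < g.inner x (g.grad t x) (T x))
    {v : TangentSpace (𝓡 (m + 1)) x} :
    g.IsFutureCausal T v ↔ g.IsFutureCausal (fun x ↦ -g.grad t x) v := by
  rw [isFutureCausal_neg_grad_iff]
  refine and_congr_right fun hv ↦ imp_congr_right fun hv0 ↦ ⟨fun h ↦ ?_, fun h ↦ ?_⟩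
  · by_contra hn
    have h1 := g.inner_nonpos_of_causal hN (v := -v) (w := T x) (by simpa using hv) hT.le
      (by simpa using hn) hpos.le
    rw [map_neg, neg_apply] at h1
    linarith
  · refine lt_of_le_of_ne (g.inner_nonpos_of_causal hN hv hT.le h.le hpos.le) fun h0 ↦ hv0 ?_
    exact g.eq_zero_of_orthogonal hT hv (by rw [g.symm, h0])

theorem inner_grad_ne_zero {x : M} (hN : g.IsTimelike (g.grad t x)) (hT : g.IsTimelike (T x)) :
    g.inner x (g.grad t x) (T x) ≠ 0 := fun h ↦ by
  have h1 := g.eq_zero_of_orthogonal hN hT.le h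
  rw [IsTimelike, h1] at hT
  simp at hT

/-- The function is `dt(T)`, read off from the tangent map of `t` along `T`; no regularity of the
gradient field is needed. -/
theorem continuous_inner_grad (ht : ContMDiff (𝓡 (m + 1)) 𝓘(ℝ, ℝ) ∞ t)
    (hT : g.IsTimeOrientation T) : Continuous fun x ↦ g.inner x (g.grad t x) (T x) := by
  have h1 : Continuous fun p : TangentBundle 𝓘(ℝ, ℝ) ℝ ↦ (p.2 : ℝ) :=
    (contMDiff_snd_tangentBundle_modelSpace (n := 0) ℝ 𝓘(ℝ, ℝ)).continuous
  have h2 := h1.comp ((ht.continuous_tangentMap (by simp)).comp hT.1.continuous)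
  refine h2.congr fun x ↦ ?_
  rw [g.inner_grad]
  rfl

/-- The sign of `⟨grad t, T⟩` does not change along a causal line. -/
theorem inner_grad_pos_of_isCausalLine (ht : g.IsTimeFunction t) (hT : ∀ x, g.IsTimelike (T x))
    (hcont : Continuous fun x ↦ g.inner x (g.grad t x) (T x)) {c : ℝ → M} (hc : Continuous c)
    {u v : ℝ} (hu : 0 < g.inner (c u) (g.grad t (c u)) (T (c u))) :
    0 < g.inner (c v) (g.grad t (c v)) (T (c v)) := by
  by_contra hn
  obtain ⟨w, hw⟩ := mem_range_of_exists_le_of_exists_ge (hcont.comp hc) ⟨v, not_lt.1 hn⟩ ⟨u, hu.le⟩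
  exact inner_grad_ne_zero (ht.2 (c w)) (hT (c w)) hw

/-- The causal future only depends on the side of the orientation at the base point. -/
theorem mem_causalFuture_iff_of_pos (ht : g.IsTimeFunction t) (hT : ∀ x, g.IsTimelike (T x))
    (hcont : Continuous fun x ↦ g.inner x (g.grad t x) (T x)) {p : M}
    (hpos : 0 < g.inner p (g.grad t p) (T p)) (q : M) :
    q ∈ g.causalFuture T p ↔ q ∈ g.causalFuture (fun x ↦ -g.grad t x) p := by
  constructor <;> intro h <;> obtain ⟨c, hc, h0, h1⟩ := exists_isCausalLine h <;>
    obtain rfl : c 0 = p := h0 0 (by norm_num) <;>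
    obtain rfl : c 1 = q := h1 1 (by norm_num)
  · have hc' : g.IsCausalLine (fun x ↦ -g.grad t x) c := ⟨hc.1, fun u ↦
      (isFutureCausal_iff_of_pos (ht.2 _) (hT _)
        (inner_grad_pos_of_isCausalLine ht hT hcont hc.1.continuous hpos)).1 (hc.2 u)⟩
    exact hc'.mem_causalFuture zero_le_one
  · have hc' : g.IsCausalLine T c := ⟨hc.1, fun u ↦
      (isFutureCausal_iff_of_pos (ht.2 _) (hT _)
        (inner_grad_pos_of_isCausalLine ht hT hcont hc.1.continuous hpos)).2 (hc.2 u)⟩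
    exact hc'.mem_causalFuture zero_le_one

theorem inner_grad_pos_of_mem_causalFuture (ht : g.IsTimeFunction t)
    (hT : ∀ x, g.IsTimelike (T x)) (hcont : Continuous fun x ↦ g.inner x (g.grad t x) (T x))
    {T' : (x : M) → TangentSpace (𝓡 (m + 1)) x} {p q : M} (hpq : q ∈ g.causalFuture T' p) :
    0 < g.inner p (g.grad t p) (T p) ↔ 0 < g.inner q (g.grad t q) (T q) := by
  obtain ⟨c, hc, h0, h1⟩ := exists_isCausalLine hpq
  obtain rfl : c 0 = p := h0 0 (by norm_num)
  obtain rfl : c 1 = q := h1 1 (by norm_num)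
  exact ⟨inner_grad_pos_of_isCausalLine ht hT hcont hc.1.continuous,
    inner_grad_pos_of_isCausalLine ht hT hcont hc.1.continuous⟩

/-- A time function whose nonempty slices are Cauchy hypersurfaces. -/
def IsCauchyTimeFunction (g : LorentzMetric m M) (t : M → ℝ) : Prop :=
  g.IsTimeFunction t ∧
    ∀ a ∈ range t, g.domainOfDependence (fun x ↦ -g.grad t x) (t ⁻¹' {a}) = univ

/-- Reversing time keeps the slices and exchanges the two domains of dependence. Statements about
the past thus follow from those about the future. -/
theorem IsCauchyTimeFunction.neg (h : g.IsCauchyTimeFunction t) :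
    g.IsCauchyTimeFunction fun x ↦ -t x := by
  refine ⟨h.1.neg, ?_⟩
  rintro _ ⟨x, rfl⟩
  have h1 := h.2 (t x) ⟨x, rfl⟩
  have h2 : (fun x ↦ -t x) ⁻¹' {-t x} = t ⁻¹' {t x} := by
    ext y
    simp
  rw [neg_grad_neg, h2, ← h1, domainOfDependence, domainOfDependence, futureDomain, futureDomain,
    union_comm]
  simp only [neg_neg]

variable [T2Space M]

/-- The Cauchy property concerns only nonempty slices, so the level is the value of `t` at a point
strictly later than `q`. -/
theorem IsCauchyTimeFunction.isCompact_inter (h : g.IsCauchyTimeFunction t) {p q : M}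
    (hpq : t p ≤ t q) :
    ∃ a > t q, IsCompact (g.causalFuture (fun x ↦ -g.grad t x) p ∩ {x | t x ≤ a}) := by
  obtain ⟨y, -, hlt⟩ := h.1.exists_lt q
  refine ⟨t y, hlt, h.1.isCompact_causalFuture_inter (h.1.mem_pastDomain ?_ (hpq.trans_lt hlt))⟩
  rw [h.2 _ ⟨y, rfl⟩]
  exact mem_univ p

/-- For a limit point `q` and `a > t q`, the set `t < a` is a neighbourhood of `q` in which the
future lies in a compact, hence closed, part of itself. -/
theorem IsCauchyTimeFunction.isClosed_causalFuture (h : g.IsCauchyTimeFunction t) (p : M) :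
    IsClosed (g.causalFuture (fun x ↦ -g.grad t x) p) := by
  refine isClosed_of_closure_subset fun q hq ↦ ?_
  have hpq : t p ≤ t q := closure_minimal (fun y hy ↦ le_of_mem_causalFuture h.1.1 hy)
    (isClosed_le continuous_const h.1.1.continuous) hq
  obtain ⟨a, ha, hK⟩ := h.isCompact_inter hpq
  have h1 := (isOpen_lt h.1.1.continuous (continuous_const (y := a))).inter_closure ⟨ha, hq⟩
  have h2 := closure_mono (t := g.causalFuture (fun x ↦ -g.grad t x) p ∩ {x | t x ≤ a})
    (fun y hy ↦ ⟨hy.2, (show t y < a from hy.1).le⟩) h1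
  rw [hK.isClosed.closure_eq] at h2
  exact h2.1

theorem IsCauchyTimeFunction.isClosed_and_isCompact (h : g.IsCauchyTimeFunction t)
    (hT : ∀ x, g.IsTimelike (T x)) (hcont : Continuous fun x ↦ g.inner x (g.grad t x) (T x))
    {p : M} (hpos : 0 < g.inner p (g.grad t p) (T p)) (q : M) :
    IsClosed (g.causalFuture T p) ∧ IsCompact (g.causalFuture T p ∩ g.causalPast T q) := by
  have hp : g.causalFuture T p = g.causalFuture (fun x ↦ -g.grad t x) p :=
    Set.ext (mem_causalFuture_iff_of_pos h.1 hT hcont hpos)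
  have hcl := h.isClosed_causalFuture p
  rw [hp]
  refine ⟨hcl, ?_⟩
  -- `M` need not be connected. A common point `r` carries the sign of `⟨grad t, T⟩` from `p` to `q`
  -- along causal curves, and also gives `t p ≤ t q`.
  rcases (g.causalFuture (fun x ↦ -g.grad t x) p ∩ g.causalPast T q).eq_empty_or_nonempty
    with he | ⟨r, hpr, hqr⟩
  · rw [he]
    exact isCompact_empty
  have hposq : 0 < g.inner q (g.grad t q) (T q) :=
    (inner_grad_pos_of_mem_causalFuture h.1 hT hcont hqr).2
      ((inner_grad_pos_of_mem_causalFuture h.1 hT hcont hpr).1 hpos)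
  have hd : ∀ x, g.inner x (g.grad (fun x ↦ -t x) x) (-T x) = g.inner x (g.grad t x) (T x) :=
    fun x ↦ by simp [g.grad_neg]
  have hq : g.causalPast T q = g.causalFuture (fun x ↦ -g.grad (fun x ↦ -t x) x) q :=
    Set.ext (mem_causalFuture_iff_of_pos (T := fun x ↦ -T x) h.neg.1
      (fun x ↦ by simpa [IsTimelike] using hT x) (by simpa only [hd] using hcont)
      (by rwa [hd]))
  rw [hq] at hqr ⊢
  have hle : ∀ x ∈ g.causalFuture (fun x ↦ -g.grad (fun x ↦ -t x) x) q, t x ≤ t q :=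
    fun x hx ↦ neg_le_neg_iff.1 (le_of_mem_causalFuture h.neg.1.1 hx)
  obtain ⟨a, ha, hK⟩ := h.isCompact_inter ((le_of_mem_causalFuture h.1.1 hpr).trans (hle r hqr))
  exact hK.of_isClosed_subset (hcl.inter (h.neg.isClosed_causalFuture q))
    fun x hx ↦ ⟨hx.1, (hle x hx.2).trans ha.le⟩

end LorentzMetric

end

theorem mainTheorem6 (m : ℕ) (M : Type*) [TopologicalSpace M] [T2Space M]
    [SecondCountableTopology M] [ChartedSpace (EuclideanSpace ℝ (Fin (m + 1))) M]
    [IsManifold (𝓡 (m + 1)) ∞ M] (g : LorentzMetric m M) (hg : g.IsGloballyHyperbolic)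
    (T : (x : M) → TangentSpace (𝓡 (m + 1)) x) (hT : g.IsTimeOrientation T) (p q : M) :
    IsClosed (g.causalFuture T p) ∧
      IsCompact (g.causalFuture T p ∩ g.causalPast T q) := by
  obtain ⟨-, t, ht, hD⟩ := hg
  have h : g.IsCauchyTimeFunction t := ⟨ht, hD⟩
  -- If `T` points to the side of `grad t` at `p`, the time function `-t` is used instead.
  rcases lt_or_gt_of_ne (LorentzMetric.inner_grad_ne_zero (ht.2 p) (hT.2 p)) with hp | hp
  · refine h.neg.isClosed_and_isCompact hT.2 (LorentzMetric.continuous_inner_grad ht.neg.1 hT) ?_ q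
    rw [g.grad_neg]
    simpa using hp
  · exact h.isClosed_and_isCompact hT.2 (LorentzMetric.continuous_inner_grad ht.1 hT) hp q
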